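/- \textbf{Setting.} Let $\Delta=\{\alpha_1,\dots,\alpha_n\}$ be the (arbitrarily numbered) simple roots of an irreducible reduced crystallographic root system $\Pi$ (i.e. of a simple Lie algebra) spanning a Euclidean space $V$ of dimension $n$ with scalar product $\langle\cdot,\cdot\rangle$. Put $\alpha^\vee=2\alpha/\langle\alpha,\alpha\rangle$ for $\alpha\in\Pi$. Let $W$ be the Weyl group, generated by the reflections $r_ia=a-\langle a,\alpha_i^\vee\rangle\alpha_i$; let $Q^\vee=\mathbb{Z}\alpha_1^\vee+\dots+\mathbb{Z}\alpha_n^\vee$ and $P=\{\omega\in V:\langle\omega,\alpha_i^\vee\rangle\in\mathbb{Z}\text{ for all }i\}$; let $\xi$ be the highest root and $\eta$ the highest root of the dual root system $\Pi^\vee=\{\alpha^\vee:\alpha\in\Pi\}$ (with respect to the simple roots $\alpha_i^\vee$). The affine Weyl group $W^{\mathrm{aff}}=Q^\vee\rtimes W$ and the extended dual affine Weyl group $W^{\mathrm{aff}}_P=P\rtimes W$ act on $V$ by $T(p)w\cdot b=wb+p$; let $\psi$ and $\widehat\psi$ denote their retractions $T(p)w\mapsto w$ to $W$. Let $\sigma:W\to\{\pm1\}$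 be any homomorphism and $M\ge 1$ an integer. Define: \begin{itemize} \item $F=\{a\in V:\langle a,\alpha_i\rangle\ge0\ (1\le i\le n),\ \langle a,\xi\rangle\le1\}$ and $F^\sigma=\{a\in F:\sigma\circ\psi(\mathrm{Stab}_{W^{\mathrm{aff}}}(a))=\{1\}\}$; \item the Kac coordinates $[b_0,\dots,b_n]$ of $b\in V$, where $b_i=\langle b,\alpha_i^\vee\rangle$ for $1\le i\le n$ and $b_0=1-\langle b,\eta\rangle$; the set $F_Q=\{b\in V: b_0,\dots,b_n\ge0\}$; the group $\Gamma=\{\gamma\in W^{\mathrm{aff}}_P:\gamma\cdot F_Q=F_Q\}$; the set $F_P$ of those $b\in F_Q$ whose Kac coordinates are lexicographically highest among the points of $\Gamma b$; and $F_P^\sigma=\{b\in F_P:\sigma\circ\widehat\psi(\mathrm{Stab}_{W_P^{\mathrm{aff}}}(b))=\{1\}\}$; \item the point set $F^\sigma_{Q^\vee,M}=\frac1M Q^\vee\cap F^\sigma$ and the weight set $\Lambda^\sigma_{P,M}=P\cap MF^\sigma_P$; \item $\varepsilon(a)=|W|/|\mathrm{Stab}_{W^{\mathrm{aff}}}(a)|$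 and $h_{P,M}(b)=|\mathrm{Stab}_{W_P^{\mathrm{aff}}}(b/M)|$; \item the Weyl orbit functions $\varphi^\sigma_b(a)=\sum_{w\in W}\sigma(w)\,e^{2\pi i\langle wb,a\rangle}$, and for $f,g:F^\sigma_{Q^\vee,M}\to\mathbb{C}$ the scalar product $\langle f,g\rangle^\sigma_M=\sum_{s\in F^\sigma_{Q^\vee,M}}\varepsilon(s)f(s)\overline{g(s)}$. \end{itemize} \textbf{Theorem.} The group $W$ and the set $F^\sigma_{Q^\vee,M}$ are finite, and for all $\lambda,\lambda'\in\Lambda^\sigma_{P,M}$, $$\langle\varphi^\sigma_\lambda,\varphi^\sigma_{\lambda'}\rangle^\sigma_M=|W|\,M^n\,h_{P,M}(\lambda)\,\delta_{\lambda\lambda'}.$$ -/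

import Mathlib

open scoped InnerProductSpace

noncomputable section

/-- A numbered set of simple roots `α₁, …, αₙ` of a simple Lie algebra, in a Euclidean space `V`:
an irreducible, reduced, crystallographic root system in `V` whose coroots are the vectors
`α^∨ = 2 α / ⟨α, α⟩` of the same space `V` (the duality between roots and coroots being the scalar
product), a base of it, and a numbering of the base by `{1, …, n}` (here `Fin n`). -/
structure SimpleRoots (ι V : Type*) [NormedAddCommGroup V] [InnerProductSpace ℝ V] (n : ℕ) where
  R : RootPairing ι ℝ V V
  finite : Finite ι
  isRootSystem : R.IsRootSystem
  isCrystallographic : R.IsCrystallographic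
  isReduced : R.IsReduced
  isIrreducible : R.IsIrreducible
  pairing_eq_inner : ∀ x y : V, R.toLinearMap x y = ⟪x, y⟫_ℝ
  coroot_eq : ∀ i : ι, R.coroot i = (2 / ⟪R.root i, R.root i⟫_ℝ) • R.root i
  base : R.Base
  numbering : Fin n ≃ base.support

/-- The action of a group `W` of linear maps on a `W`-stable lattice `L`. -/
def latticeAction {V : Type*} [AddCommGroup V] [Module ℝ V] (W : Subgroup (V ≃ₗ[ℝ] V))
    (L : AddSubgroup V) (h : ∀ w ∈ W, ∀ x ∈ L, w x ∈ L) : W →* MulAut (Multiplicative L) where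
  toFun w := AddEquiv.toMultiplicative
    { toFun := fun x => ⟨(w : V ≃ₗ[ℝ] V) x, h _ w.2 _ x.2⟩
      invFun := fun x => ⟨((w⁻¹ : W) : V ≃ₗ[ℝ] V) x, h _ (w⁻¹).2 _ x.2⟩
      left_inv := fun x => Subtype.ext (by simp)
      right_inv := fun x => Subtype.ext (by simp)
      map_add' := fun x y => Subtype.ext (by simp) }
  map_one' := by ext x; rfl
  map_mul' := fun v w => by ext x; rfl

/-- The semidirect product `L ⋊ W` of the translations by a `W`-stable lattice `L` and of a linear
group `W`. -/
def LatticeSemidirect {V : Type*} [AddCommGroup V] [Module ℝ V] (W : Subgroup (V ≃ₗ[ℝ] V))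
    (L : AddSubgroup V) (h : ∀ w ∈ W, ∀ x ∈ L, w x ∈ L) : Type _ :=
  Multiplicative L ⋊[latticeAction W L h] W

namespace LatticeSemidirect

variable {V : Type*} [AddCommGroup V] [Module ℝ V] {W : Subgroup (V ≃ₗ[ℝ] V)}
    {L : AddSubgroup V} {h : ∀ w ∈ W, ∀ x ∈ L, w x ∈ L}

instance : Group (LatticeSemidirect W L h) :=
  inferInstanceAs (Group (Multiplicative L ⋊[latticeAction W L h] W))

/-- The translation vector `p` of `T(p) w`. -/
def trans (g : LatticeSemidirect W L h) : L :=
  Multiplicative.toAdd (SemidirectProduct.left g)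

/-- The retraction homomorphism `T(p) w ↦ w`. -/
def retraction : LatticeSemidirect W L h →* W :=
  SemidirectProduct.rightHom

/-- The action `T(p) w · b = w b + p`. -/
instance : MulAction (LatticeSemidirect W L h) V where
  smul g b := (retraction g : V ≃ₗ[ℝ] V) b + (trans g : V)
  one_smul b := by
    change b + (0 : V) = b
    simp
  mul_smul g g' b := by
    change (retraction g : V ≃ₗ[ℝ] V) ((retraction g' : V ≃ₗ[ℝ] V) b) +
        ((trans g : V) + (retraction g : V ≃ₗ[ℝ] V) (trans g' : V)) =
      (retraction g : V ≃ₗ[ℝ] V) ((retraction g' : V ≃ₗ[ℝ] V) b + (trans g' : V)) + (trans g : V)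
    rw [map_add]
    abel

theorem smul_def (g : LatticeSemidirect W L h) (b : V) :
    g • b = (retraction g : V ≃ₗ[ℝ] V) b + (trans g : V) := rfl

end LatticeSemidirect

/-- `ξ` is the highest element of `Φ` for the order `ν ≤ μ ↔ μ - ν ∈ ℕ β₁ + ⋯ + ℕ βₙ`. -/
def IsHighest {V : Type*} [AddCommGroup V] {n : ℕ} (β : Fin n → V) (Φ : Set V) (ξ : V) : Prop :=
  ξ ∈ Φ ∧ ∀ γ ∈ Φ, ∃ k : Fin n → ℕ, ξ - γ = ∑ i, k i • β i

namespace SimpleRoots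

variable {ι V : Type*} [NormedAddCommGroup V] [InnerProductSpace ℝ V] {n : ℕ}
  (S : SimpleRoots ι V n)

/-- The simple root `αᵢ`. -/
def simpleRoot (i : Fin n) : V := S.R.root (S.numbering i)

/-- The dual simple root `αᵢ^∨ = 2 αᵢ / ⟨αᵢ, αᵢ⟩`. -/
def simpleCoroot (i : Fin n) : V := S.R.coroot (S.numbering i)

/-- The reflection `rᵢ`. -/
def simpleReflection (i : Fin n) : V ≃ₗ[ℝ] V := S.R.reflection (S.numbering i)

theorem simpleReflection_apply (i : Fin n) (x : V) :
    S.simpleReflection i x = x - ⟪x, S.simpleCoroot i⟫_ℝ • S.simpleRoot i := by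
  simp only [simpleReflection, simpleRoot, simpleCoroot, ← S.pairing_eq_inner]
  exact RootPairing.reflection_apply _ _ _

/-- The Weyl group `W = ⟨r₁, …, rₙ⟩`. -/
def W : Subgroup (V ≃ₗ[ℝ] V) := Subgroup.closure (Set.range S.simpleReflection)

/-- The dual root lattice `Q^∨ = ℤ α₁^∨ + ⋯ + ℤ αₙ^∨`. -/
def Qdual : AddSubgroup V := AddSubgroup.closure (Set.range S.simpleCoroot)

/-- The weight lattice `P = {ω | ⟨ω, αᵢ^∨⟩ ∈ ℤ for all i}`. -/
def weightLattice : AddSubgroup V where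
  carrier := {ω | ∀ i, ∃ k : ℤ, ⟪ω, S.simpleCoroot i⟫_ℝ = k}
  zero_mem' := fun i => ⟨0, by simp⟩
  add_mem' := fun {x y} hx hy i => by
    obtain ⟨k, hk⟩ := hx i
    obtain ⟨l, hl⟩ := hy i
    exact ⟨k + l, by rw [inner_add_left, hk, hl]; push_cast; rfl⟩
  neg_mem' := fun {x} hx i => by
    obtain ⟨k, hk⟩ := hx i
    exact ⟨-k, by rw [inner_neg_left, hk]; push_cast; rfl⟩

theorem cartan_int (i j : Fin n) : ∃ k : ℤ, ⟪S.simpleRoot i, S.simpleCoroot j⟫_ℝ = k := by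
  have := S.isCrystallographic
  obtain ⟨k, hk⟩ := S.R.exists_value (S := ℤ) (S.numbering i) (S.numbering j)
  refine ⟨k, ?_⟩
  rw [simpleRoot, simpleCoroot, ← S.pairing_eq_inner]
  simpa using hk.symm

theorem coroot_reflection (i j : Fin n) : S.simpleReflection i (S.simpleCoroot j) =
    S.simpleCoroot j - ⟪S.simpleRoot i, S.simpleCoroot j⟫_ℝ • S.simpleCoroot i := by
  rw [simpleReflection_apply]
  congr 1
  have h1 : S.simpleCoroot i =
      (2 / ⟪S.simpleRoot i, S.simpleRoot i⟫_ℝ) • S.simpleRoot i := S.coroot_eq _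
  rw [h1, inner_smul_right, smul_smul, real_inner_comm (S.simpleCoroot j),
    mul_comm]

theorem stable_of_simpleReflection (L : AddSubgroup V)
    (h : ∀ i, ∀ x ∈ L, S.simpleReflection i x ∈ L) : ∀ w ∈ S.W, ∀ x ∈ L, w x ∈ L := by
  intro w hw
  induction hw using Subgroup.closure_induction_left with
  | one => exact fun x hx => hx
  | mul_left r hr w _ ih =>
    obtain ⟨i, rfl⟩ := hr
    exact fun x hx => h i _ (ih x hx)
  | inv_mul_cancel r hr w _ ih =>
    obtain ⟨i, rfl⟩ := hr
    intro x hx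
    have : (S.simpleReflection i)⁻¹ = S.simpleReflection i := S.R.reflection_inv _
    rw [this]
    exact h i _ (ih x hx)

theorem weightLattice_stable : ∀ w ∈ S.W, ∀ x ∈ S.weightLattice, w x ∈ S.weightLattice := by
  refine S.stable_of_simpleReflection _ fun i x hx j => ?_
  obtain ⟨k, hk⟩ := hx i
  obtain ⟨l, hl⟩ := hx j
  obtain ⟨c, hc⟩ := S.cartan_int i j
  refine ⟨l - k * c, ?_⟩
  rw [simpleReflection_apply, inner_sub_left, inner_smul_left, hk, hl, hc]
  simp

theorem Qdual_stable : ∀ w ∈ S.W, ∀ x ∈ S.Qdual, w x ∈ S.Qdual := by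
  refine S.stable_of_simpleReflection _ fun i x hx => ?_
  induction hx using AddSubgroup.closure_induction with
  | mem x hx =>
    obtain ⟨j, rfl⟩ := hx
    obtain ⟨c, hc⟩ := S.cartan_int i j
    rw [coroot_reflection, hc]
    have hj : ∀ j, S.simpleCoroot j ∈ S.Qdual :=
      fun j => AddSubgroup.subset_closure ⟨j, rfl⟩
    refine sub_mem (hj j) ?_
    rw [Int.cast_smul_eq_zsmul]
    exact zsmul_mem (hj i) c
  | zero => simp
  | add x y _ _ hx hy => simpa using S.Qdual.add_mem hx hy
  | neg x _ hx => simpa using S.Qdual.neg_mem hx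

/-- The affine Weyl group `W^aff = Q^∨ ⋊ W`. -/
abbrev Waff : Type _ := LatticeSemidirect S.W S.Qdual S.Qdual_stable

/-- The extended dual affine Weyl group `W_P^aff = P ⋊ W`. -/
abbrev WaffP : Type _ := LatticeSemidirect S.W S.weightLattice S.weightLattice_stable

/-- The highest root `ξ`. -/
def highestRoot : V :=
  Classical.epsilon (IsHighest S.simpleRoot (Set.range S.R.root))

/-- The highest dual root `η`. -/
def highestDualRoot : V :=
  Classical.epsilon (IsHighest S.simpleCoroot (Set.range S.R.coroot))

/-- The fundamental domain `F` of `W^aff`, i.e. the set of all `a = a₁ ω₁^∨ + ⋯ + aₙ ωₙ^∨` with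
`a₀ + m₁ a₁ + ⋯ + mₙ aₙ = 1` and `a₀, …, aₙ ≥ 0`. For `ξ = m₁ α₁ + ⋯ + mₙ αₙ`, the coordinates of
`a` are `aᵢ = ⟨a, αᵢ⟩`, and `m₁ a₁ + ⋯ + mₙ aₙ = ⟨a, ξ⟩`. -/
def F : Set V := {a | (∀ i, 0 ≤ ⟪a, S.simpleRoot i⟫_ℝ) ∧ 0 ≤ 1 - ⟪a, S.highestRoot⟫_ℝ}

/-- The Kac coordinates `[b₀, b₁, …, bₙ]` of `b = b₁ ω₁ + ⋯ + bₙ ωₙ`, where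
`b₀ + m₁^∨ b₁ + ⋯ + mₙ^∨ bₙ = 1` for `η = m₁^∨ α₁^∨ + ⋯ + mₙ^∨ αₙ^∨`. Here `bᵢ = ⟨b, αᵢ^∨⟩` and
`m₁^∨ b₁ + ⋯ + mₙ^∨ bₙ = ⟨b, η⟩`. -/
def kac (b : V) : Fin (n + 1) → ℝ :=
  Fin.cons (1 - ⟪b, S.highestDualRoot⟫_ℝ) (fun i => ⟪b, S.simpleCoroot i⟫_ℝ)

/-- The fundamental domain `F_Q` of the dual affine Weyl group `Q ⋊ W`. -/
def FQ : Set V := {b | ∀ i, 0 ≤ S.kac b i}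

/-- The set `Γ` of the elements of `W_P^aff` that leave `F_Q` invariant. -/
def Γ : Set S.WaffP := {γ | (fun b : V => γ • b) '' S.FQ = S.FQ}

/-- The fundamental domain `F_P` of `W_P^aff`: the points of `F_Q` whose Kac coordinates are
lexicographically highest among those of their `Γ`-orbit. -/
def FP : Set V := {b | b ∈ S.FQ ∧ ∀ γ ∈ S.Γ, toLex (S.kac (γ • b)) ≤ toLex (S.kac b)}

/-- `F^σ = {a ∈ F | σ ∘ ψ (Stab_{W^aff} (a)) = {1}}`. -/
def Fsign (σ : S.W →* ℤˣ) : Set V :=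
  {a | a ∈ S.F ∧ ∀ g ∈ MulAction.stabilizer S.Waff a, σ (LatticeSemidirect.retraction g) = 1}

/-- `F_P^σ = {b ∈ F_P | σ ∘ ψ̂ (Stab_{W_P^aff} (b)) = {1}}`. -/
def FPsign (σ : S.W →* ℤˣ) : Set V :=
  {b | b ∈ S.FP ∧ ∀ g ∈ MulAction.stabilizer S.WaffP b, σ (LatticeSemidirect.retraction g) = 1}

/-- The point set `F^σ_{Q^∨,M} = (1/M) Q^∨ ∩ F^σ`. -/
def points (σ : S.W →* ℤˣ) (M : ℕ) : Set V :=
  {s | (∃ q ∈ S.Qdual, s = (M : ℝ)⁻¹ • q) ∧ s ∈ S.Fsign σ}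

/-- The weight set `Λ^σ_{P,M} = P ∩ M F_P^σ`. -/
def weights (σ : S.W →* ℤˣ) (M : ℕ) : Set V :=
  {l | l ∈ S.weightLattice ∧ ∃ b ∈ S.FPsign σ, l = (M : ℝ) • b}

/-- `ε(a) = |W| / |Stab_{W^aff} (a)|`. -/
def ε (a : V) : ℝ := (Nat.card S.W : ℝ) / Nat.card (MulAction.stabilizer S.Waff a)

/-- `h_{P,M}(b) = |Stab_{W_P^aff} (b / M)|`. -/
def hP (M : ℕ) (b : V) : ℕ := Nat.card (MulAction.stabilizer S.WaffP ((M : ℝ)⁻¹ • b))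

/-- The Weyl orbit function `φ^σ_b(a) = ∑_{w ∈ W} σ(w) e^{2 π i ⟨w b, a⟩}`. -/
def orbitFunction (σ : S.W →* ℤˣ) (b a : V) : ℂ :=
  ∑ᶠ w : S.W, ((σ w : ℤ) : ℂ) *
    Complex.exp (2 * Real.pi * Complex.I * (⟪(w : V ≃ₗ[ℝ] V) b, a⟫_ℝ : ℝ))

/-- The scalar product `⟨f, g⟩ = ∑_s ε(s) f(s) \overline{g(s)}` of functions on `F^σ_{Q^∨,M}`. -/
def scalarProduct (σ : S.W →* ℤˣ) (M : ℕ) (f g : S.points σ M → ℂ) : ℂ :=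
  ∑ᶠ s : S.points σ M, (S.ε s : ℂ) * f s * starRingEnd ℂ (g s)

end SimpleRoots

end

/-! ### Roots, coroots and the scalar product -/

namespace SimpleRoots

variable {ι V : Type*} [NormedAddCommGroup V] [InnerProductSpace ℝ V] {n : ℕ}
  (S : SimpleRoots ι V n)

/-! Write `λ = M b` and `λ' = M b'` with `b, b'` in `F_P`. Under `a ↦ v a + q` an orbit function is
multiplied by `σ v` (`orbitFunction_map_add`), so `φ_λ` times the conjugate of `φ_λ'` is invariant
under `W^aff`, and both factors vanish on `F` outside `F^σ` (`orbitFunction_eq_zero`). By orbit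
counting, the weights `ε` turn the sum over the points of `F^σ` into the plain sum over the group
`(1/M) Q^∨ / Q^∨`, which is `(ℤ/M)^n` (`sum_ε_mul_eq_sum_gridPoint`). Expanding the product gives
characters `e^{2πi⟨vλ - wλ', ·⟩}` of this group; each sums to `M^n` if `v b - w b' ∈ P` and to `0`
otherwise (`sum_expTurn_gridPoint`).

If some term survives, `b` and `b'` lie in one orbit of `W_P^aff`, hence `b = b'` (`eq_of_mem_FP`).
If `b = b'`, then for each `v` the surviving `w` are the `v u` with `u` in the retraction of the
stabilizer of `b`. There `σ u = 1`, so each of the `|W|` values of `v` contributes `M^n h`.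

The geometric input is that `F` is a strict fundamental domain of `W^aff`. Every orbit meets `F`
(`exists_map_add_mem_F`) by minimizing the distance to a point of the alcove. It does so only once
(`map_add_eq_self_of_mem_F`) by the exchange condition for words in the reflections of the walls,
together with the fact that these reflections generate all translations by `Q^∨`. The same results
for the dual root system, where `F` becomes `F_Q`, reduce `F_P` to the lexicographic choice within
orbits of `Γ`. -/

instance : S.R.IsRootSystem := S.isRootSystem
instance : S.R.IsCrystallographic := S.isCrystallographic
instance : S.R.IsReduced := S.isReduced
instance : S.R.IsIrreducible := S.isIrreducible

theorem pairing_eq (i j : ι) : S.R.pairing i j = ⟪S.R.root i, S.R.coroot j⟫_ℝ := by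
  rw [← S.pairing_eq_inner]; rfl

theorem reflection_apply (i : ι) (x : V) :
    S.R.reflection i x = x - ⟪x, S.R.coroot i⟫_ℝ • S.R.root i := by
  rw [← S.pairing_eq_inner]
  exact RootPairing.reflection_apply _ _ _

theorem inner_coroot (x : V) (i : ι) : ⟪x, S.R.coroot i⟫_ℝ =
    2 / ⟪S.R.root i, S.R.root i⟫_ℝ * ⟪x, S.R.root i⟫_ℝ := by
  rw [S.coroot_eq, inner_smul_right]

theorem inner_root_self_pos (i : ι) : 0 < ⟪S.R.root i, S.R.root i⟫_ℝ :=
  real_inner_self_pos.2 (S.R.ne_zero i)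

theorem reflection_apply' (i : ι) (x : V) :
    S.R.reflection i x = x - ⟪x, S.R.root i⟫_ℝ • S.R.coroot i := by
  rw [reflection_apply, inner_coroot, S.coroot_eq, smul_smul, mul_comm]

theorem inner_reflection_left (i : ι) (x y : V) :
    ⟪S.R.reflection i x, y⟫_ℝ = ⟪x, S.R.reflection i y⟫_ℝ := by
  rw [reflection_apply, reflection_apply', inner_sub_left, inner_sub_right, real_inner_smul_left,
    real_inner_smul_right, real_inner_comm (S.R.root i) y, mul_comm]

theorem reflection_coroot (i j : ι) :
    S.R.reflection i (S.R.coroot j) = S.R.coroot (S.R.reflectionPerm i j) := by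
  rw [S.R.coroot_reflectionPerm, RootPairing.coreflection_apply, reflection_apply',
    real_inner_comm, ← S.pairing_eq_inner]

theorem exists_pairing_eq_intCast (i j : ι) :
    ∃ k : ℤ, ⟪S.R.root i, S.R.coroot j⟫_ℝ = k := by
  obtain ⟨k, hk⟩ := S.R.exists_value (S := ℤ) i j
  exact ⟨k, by rw [← pairing_eq]; simpa using hk.symm⟩

theorem pairingIn_cast (i j : ι) :
    ((S.R.pairingIn ℤ i j : ℤ) : ℝ) = ⟪S.R.root i, S.R.coroot j⟫_ℝ := by
  rw [← pairing_eq]; simpa using S.R.algebraMap_pairingIn ℤ i j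

theorem pairingIn_pos_iff (i j : ι) :
    0 < S.R.pairingIn ℤ i j ↔ 0 < ⟪S.R.root i, S.R.root j⟫_ℝ := by
  rw [← Int.cast_pos (R := ℝ), pairingIn_cast, inner_coroot]
  exact mul_pos_iff_of_pos_left (div_pos two_pos (S.inner_root_self_pos j))

/-- The simple roots as a basis of `V`. -/
noncomputable def rootBasis : Module.Basis (Fin n) ℝ V :=
  S.base.toWeightBasis.reindex S.numbering.symm

@[simp] theorem rootBasis_apply (i : Fin n) : S.rootBasis i = S.simpleRoot i := by
  simp [rootBasis, simpleRoot]

/-- The simple coroots as a basis of `V`. -/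
noncomputable def corootBasis : Module.Basis (Fin n) ℝ V :=
  S.base.toCoweightBasis.reindex S.numbering.symm

@[simp] theorem corootBasis_apply (i : Fin n) : S.corootBasis i = S.simpleCoroot i := by
  simp [corootBasis, simpleCoroot]

theorem finiteDimensional (S : SimpleRoots ι V n) : FiniteDimensional ℝ V := Module.Finite.of_basis S.rootBasis

theorem range_simpleRoot : Set.range S.simpleRoot = S.R.root '' S.base.support := by
  ext x
  constructor
  · rintro ⟨i, rfl⟩
    exact ⟨_, (S.numbering i).2, rfl⟩
  · rintro ⟨i, hi, rfl⟩
    exact ⟨S.numbering.symm ⟨i, hi⟩, by simp [simpleRoot]⟩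

/-- The dual simple roots are a system of simple roots. -/
noncomputable def dual : SimpleRoots ι V n where
  R := S.R.flip
  finite := S.finite
  isRootSystem := inferInstance
  isCrystallographic := inferInstance
  isReduced := have := S.finite; inferInstance
  isIrreducible := inferInstance
  pairing_eq_inner x y := by
    rw [real_inner_comm, ← S.pairing_eq_inner]; rfl
  coroot_eq i := by
    have h := S.inner_root_self_pos i
    change S.R.root i = (2 / ⟪S.R.coroot i, S.R.coroot i⟫_ℝ) • S.R.coroot i
    rw [inner_coroot, real_inner_comm (S.R.root i) (S.R.coroot i), inner_coroot, S.coroot_eq, smul_smul]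
    rw [show 2 / (2 / ⟪S.R.root i, S.R.root i⟫_ℝ *
      (2 / ⟪S.R.root i, S.R.root i⟫_ℝ * ⟪S.R.root i, S.R.root i⟫_ℝ)) *
      (2 / ⟪S.R.root i, S.R.root i⟫_ℝ) = 1 by field_simp, one_smul]
  base := S.base.flip
  numbering := S.numbering

/-! ### The cone of the simple roots -/

/-- The additive monoid generated by the simple roots. -/
def posCone : AddSubmonoid V := AddSubmonoid.closure (Set.range S.simpleRoot)

theorem simpleRoot_mem_posCone (i : Fin n) : S.simpleRoot i ∈ S.posCone :=
  AddSubmonoid.subset_closure ⟨i, rfl⟩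

theorem exists_nat_of_mem_posCone {x : V} (hx : x ∈ S.posCone) :
    ∃ k : Fin n → ℕ, x = ∑ i, k i • S.simpleRoot i := by
  rw [posCone, ← Submodule.span_nat_eq_addSubmonoidClosure, Submodule.mem_toAddSubmonoid,
    Submodule.mem_span_range_iff_exists_fun] at hx
  obtain ⟨k, hk⟩ := hx
  exact ⟨k, hk.symm⟩

theorem root_mem_or_neg_mem_posCone (i : ι) :
    S.R.root i ∈ S.posCone ∨ -S.R.root i ∈ S.posCone := by
  rw [posCone, range_simpleRoot]
  exact S.base.root_mem_or_neg_mem i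

theorem inner_nonneg_of_mem_posCone {x γ : V} (hx : ∀ i, 0 ≤ ⟪x, S.simpleRoot i⟫_ℝ)
    (hγ : γ ∈ S.posCone) : 0 ≤ ⟪x, γ⟫_ℝ := by
  obtain ⟨k, rfl⟩ := S.exists_nat_of_mem_posCone hγ
  rw [inner_sum]
  refine Finset.sum_nonneg fun i _ => ?_
  rw [← Nat.cast_smul_eq_nsmul ℝ, inner_smul_right]
  exact mul_nonneg (Nat.cast_nonneg _) (hx i)

theorem inner_pos_of_mem_posCone {x γ : V} (hx : ∀ i, 0 < ⟪x, S.simpleRoot i⟫_ℝ)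
    (hγ : γ ∈ S.posCone) (h0 : γ ≠ 0) : 0 < ⟪x, γ⟫_ℝ := by
  obtain ⟨k, rfl⟩ := S.exists_nat_of_mem_posCone hγ
  have : ∃ i, k i ≠ 0 := by
    by_contra! h
    exact h0 (by simp [h])
  obtain ⟨i, hi⟩ := this
  rw [inner_sum]
  refine Finset.sum_pos' (fun i _ => ?_) ⟨i, Finset.mem_univ _, ?_⟩
  · rw [← Nat.cast_smul_eq_nsmul ℝ, inner_smul_right]
    exact mul_nonneg (Nat.cast_nonneg _) (hx i).le
  · rw [← Nat.cast_smul_eq_nsmul ℝ, inner_smul_right]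
    exact mul_pos (Nat.cast_pos.2 (Nat.pos_of_ne_zero hi)) (hx i)

/-- Riesz representation of a functional prescribed on a basis. With all values `1` it yields a
vector `ρ` whose scalar product measures the height of a root. -/
theorem exists_inner_simpleRoot_eq (f : Fin n → ℝ) :
    ∃ x : V, ∀ i, ⟪x, S.simpleRoot i⟫_ℝ = f i := by
  have := S.finiteDimensional
  refine ⟨(InnerProductSpace.toDual ℝ V).symm
    (LinearMap.toContinuousLinearMap (S.rootBasis.constr ℝ f)), fun i => ?_⟩
  rw [InnerProductSpace.toDual_symm_apply, LinearMap.coe_toContinuousLinearMap',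
    ← rootBasis_apply, Module.Basis.constr_basis]

theorem eq_zero_of_mem_posCone_of_neg_mem {x : V} (hx : x ∈ S.posCone) (hx' : -x ∈ S.posCone) :
    x = 0 := by
  obtain ⟨ρ, hρ⟩ := S.exists_inner_simpleRoot_eq fun _ => 1
  by_contra h
  have h1 := S.inner_pos_of_mem_posCone (x := ρ) (by simp [hρ]) hx h
  have h2 := S.inner_pos_of_mem_posCone (x := ρ) (by simp [hρ]) hx' (neg_ne_zero.2 h)
  rw [inner_neg_right] at h2
  linarith

theorem eq_of_sub_mem_posCone {x y : V} (hx : x - y ∈ S.posCone) (hy : y - x ∈ S.posCone) :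
    x = y :=
  sub_eq_zero.1 (S.eq_zero_of_mem_posCone_of_neg_mem hx (by rwa [neg_sub]))

/-! ### The highest root -/

/-- No root lies above the root `i`. -/
def IsMaximalRoot (i : ι) : Prop :=
  ∀ j, S.R.root j - S.R.root i ∈ S.posCone → j = i

/-- Among the finitely many roots above the given one, a root of greatest height is maximal. -/
theorem exists_isMaximalRoot_sub_mem (i : ι) :
    ∃ j, S.IsMaximalRoot j ∧ S.R.root j - S.R.root i ∈ S.posCone := by
  have := S.finite
  obtain ⟨ρ, hρ⟩ := S.exists_inner_simpleRoot_eq fun _ => 1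
  obtain ⟨j, hj, hmax⟩ := Set.exists_max_image {j | S.R.root j - S.R.root i ∈ S.posCone}
    (fun j => ⟪ρ, S.R.root j⟫_ℝ) (Set.toFinite _) ⟨i, by simp⟩
  refine ⟨j, fun k hk => ?_, hj⟩
  by_contra hne
  have hki : S.R.root k - S.R.root i ∈ S.posCone := by
    rw [← sub_add_sub_cancel _ (S.R.root j)]
    exact add_mem hk hj
  have h1 := hmax k hki
  have h2 := S.inner_pos_of_mem_posCone (x := ρ) (by simp [hρ]) hk
    (sub_ne_zero.2 fun h => hne (S.R.root.injective h))
  rw [inner_sub_right] at h2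
  linarith

variable {S}

theorem IsMaximalRoot.mem_posCone {i : ι} (hi : S.IsMaximalRoot i) : S.R.root i ∈ S.posCone := by
  refine (S.root_mem_or_neg_mem_posCone i).resolve_right fun h => ?_
  have := hi (S.R.reflectionPerm i i) (by
    rw [S.R.root_reflectionPerm, S.R.reflection_apply_self, sub_eq_add_neg]
    exact add_mem h h)
  have h2 := congrArg S.R.root this
  rw [S.R.root_reflectionPerm, S.R.reflection_apply_self] at h2
  have : S.R.root i + S.R.root i = 0 := by nth_rewrite 1 [← h2]; simp
  rw [← two_smul ℝ] at this
  exact S.R.ne_zero i ((smul_eq_zero.1 this).resolve_left two_ne_zero)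

/-- A negative product with a simple root would make their sum a root, lying above the maximal one.
-/
theorem IsMaximalRoot.inner_nonneg {i : ι} (hi : S.IsMaximalRoot i) (j : Fin n) :
    0 ≤ ⟪S.R.root i, S.simpleRoot j⟫_ℝ := by
  have := S.finite
  by_contra! h
  have hp : 0 < S.R.pairingIn ℤ i (S.R.reflectionPerm (S.numbering j) (S.numbering j)) := by
    rw [pairingIn_pos_iff, S.R.root_reflectionPerm, S.R.reflection_apply_self, inner_neg_right]
    exact neg_pos.2 h
  have hne : i ≠ S.R.reflectionPerm (S.numbering j) (S.numbering j) := by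
    rintro rfl
    have := hi.mem_posCone
    rw [S.R.root_reflectionPerm, S.R.reflection_apply_self] at this
    exact S.R.ne_zero _ (S.eq_zero_of_mem_posCone_of_neg_mem (S.simpleRoot_mem_posCone j) this)
  obtain ⟨k, hk⟩ := S.R.root_sub_root_mem_of_pairingIn_pos hp hne
  rw [S.R.root_reflectionPerm, S.R.reflection_apply_self, sub_neg_eq_add] at hk
  have := hi k (by
    rw [hk, add_sub_cancel_left]
    exact S.simpleRoot_mem_posCone j)
  rw [this] at hk
  exact S.R.ne_zero _ (left_eq_add.1 hk)

/-- Irreducibility enters here. Let `q` be the span of the simple roots in the support of root `j`.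
A simple root outside the support has non-positive products with those inside, but a non-negative
one with root `j`, so it is orthogonal to `q`. Hence `q` is stable under the simple reflections and
is all of `V`. If the product were `0`, root `i` would be orthogonal to each simple root of the
support, hence to `V`. -/
theorem IsMaximalRoot.inner_pos {i j : ι} (hi : S.IsMaximalRoot i) (hj : S.IsMaximalRoot j) :
    0 < ⟪S.R.root i, S.R.root j⟫_ℝ := by
  have := S.finite
  refine lt_of_le_of_ne (S.inner_nonneg_of_mem_posCone hi.inner_nonneg hj.mem_posCone)
    fun h0 => ?_
  obtain ⟨k, hk⟩ := S.exists_nat_of_mem_posCone hj.mem_posCone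
  set q : Submodule ℝ V := Submodule.span ℝ (S.simpleRoot '' {l | k l ≠ 0}) with hq
  have hmem : S.R.root j ∈ q := by
    rw [hk]
    refine sum_mem fun l _ => ?_
    by_cases hl : k l = 0
    · simp [hl]
    · exact nsmul_mem (Submodule.subset_span (Set.mem_image_of_mem S.simpleRoot hl)) _
  have horth : ∀ m l, k m = 0 → k l ≠ 0 → ⟪S.simpleRoot l, S.simpleRoot m⟫_ℝ = 0 := by
    intro m l hm
    have hle : ∀ l, k l ≠ 0 → ⟪S.simpleRoot l, S.simpleRoot m⟫_ℝ ≤ 0 := by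
      intro l hl
      by_contra! h
      have h1 := (S.pairingIn_pos_iff (S.numbering l) (S.numbering m)).2 h
      refine h1.not_ge (S.base.pairingIn_le_zero_of_ne ?_ (S.numbering l).2 (S.numbering m).2)
      intro he
      exact hl (by rw [S.numbering.injective (Subtype.ext he), hm])
    have hsum := hj.inner_nonneg m
    rw [hk, sum_inner] at hsum
    have hterm : ∀ l ∈ Finset.univ, ⟪k l • S.simpleRoot l, S.simpleRoot m⟫_ℝ ≤ 0 := by
      intro l _
      rw [← Nat.cast_smul_eq_nsmul ℝ, real_inner_smul_left]
      by_cases hl : k l = 0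
      · simp [hl]
      · exact mul_nonpos_of_nonneg_of_nonpos (Nat.cast_nonneg _) (hle l hl)
    have hzero := (Finset.sum_eq_zero_iff_of_nonpos hterm).1
      (le_antisymm (Finset.sum_nonpos hterm) hsum)
    intro hl
    have := hzero l (Finset.mem_univ _)
    rw [← Nat.cast_smul_eq_nsmul ℝ, real_inner_smul_left] at this
    exact (mul_eq_zero.1 this).resolve_left (Nat.cast_ne_zero.2 hl)
  have htop : q = ⊤ := by
    refine RootPairing.IsIrreducible.eq_top_of_invtSubmodule_reflection (P := S.R) q
      ((S.base.forall_mem_support_invtSubmodule_iff q).1 fun a ha => ?_) ?_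
    · rw [Module.End.mem_invtSubmodule]
      obtain ⟨m, hm⟩ := S.numbering.surjective ⟨a, ha⟩
      intro x hx
      change S.R.reflection a x ∈ q
      have hroot : S.R.root a = S.simpleRoot m := by rw [simpleRoot, hm]
      rw [reflection_apply, inner_coroot, hroot]
      by_cases hkm : k m = 0
      · have : ⟪x, S.simpleRoot m⟫_ℝ = 0 := by
          refine Submodule.span_induction ?_ ?_ ?_ ?_ hx
          · rintro _ ⟨l, hl, rfl⟩
            exact horth m l hkm hl
          · simp
          · intro x y _ _ h1 h2
            rw [inner_add_left, h1, h2, add_zero]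
          · intro c x _ h1
            rw [real_inner_smul_left, h1, mul_zero]
        simpa [this] using hx
      · exact sub_mem hx (Submodule.smul_mem _ _
          (Submodule.subset_span (Set.mem_image_of_mem S.simpleRoot hkm)))
    · intro h
      rw [h, Submodule.mem_bot] at hmem
      exact S.R.ne_zero j hmem
  have hzero : ∀ x ∈ q, ⟪S.R.root i, x⟫_ℝ = 0 := by
    intro x hx
    refine Submodule.span_induction ?_ ?_ ?_ ?_ hx
    · rintro _ ⟨l, hl, rfl⟩
      rw [hk, inner_sum] at h0
      have := (Finset.sum_eq_zero_iff_of_nonneg (fun l _ => by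
        rw [← Nat.cast_smul_eq_nsmul ℝ, real_inner_smul_right]
        exact mul_nonneg (Nat.cast_nonneg _) (hi.inner_nonneg l))).1 h0.symm l (Finset.mem_univ _)
      rw [← Nat.cast_smul_eq_nsmul ℝ, real_inner_smul_right] at this
      exact (mul_eq_zero.1 this).resolve_left (Nat.cast_ne_zero.2 hl)
    · simp
    · intro x y _ _ h1 h2
      rw [inner_add_right, h1, h2, add_zero]
    · intro c x _ h1
      rw [real_inner_smul_right, h1, mul_zero]
  exact (S.inner_root_self_pos i).ne' (hzero _ (htop ▸ Submodule.mem_top))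

/-- Distinct roots with positive product differ by a root; its sign contradicts the maximality of
one of them. -/
theorem IsMaximalRoot.eq {i j : ι} (hi : S.IsMaximalRoot i) (hj : S.IsMaximalRoot j) :
    i = j := by
  have := S.finite
  by_contra hne
  obtain ⟨k, hk⟩ := S.R.root_sub_root_mem_of_pairingIn_pos
    ((S.pairingIn_pos_iff i j).2 (hi.inner_pos hj)) hne
  rcases S.root_mem_or_neg_mem_posCone k with h | h
  · exact hne (hj i (hk ▸ h))
  · exact hne (hi j (by rwa [hk, neg_sub] at h)).symm

variable (S)

theorem nonempty_index (S : SimpleRoots ι V n) : Nonempty ι := by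
  have := RootPairing.IsIrreducible.nontrivial S.R
  by_contra h
  rw [not_nonempty_iff] at h
  have h1 := RootPairing.IsRootSystem.span_root_eq_top (P := S.R)
  rw [Set.range_eq_empty, Submodule.span_empty] at h1
  exact bot_ne_top h1

theorem exists_isHighest : ∃ ξ, IsHighest S.simpleRoot (Set.range S.R.root) ξ := by
  obtain ⟨i⟩ := S.nonempty_index
  obtain ⟨j, hj, -⟩ := S.exists_isMaximalRoot_sub_mem i
  refine ⟨S.R.root j, ⟨j, rfl⟩, ?_⟩
  rintro _ ⟨k, rfl⟩
  obtain ⟨l, hl, hlk⟩ := S.exists_isMaximalRoot_sub_mem k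
  rw [hl.eq hj] at hlk
  exact S.exists_nat_of_mem_posCone hlk

/-- Existence is what gives the choice by `Classical.epsilon` its meaning. -/
theorem isHighest_highestRoot :
    IsHighest S.simpleRoot (Set.range S.R.root) S.highestRoot :=
  Classical.epsilon_spec S.exists_isHighest

/-- The index of the highest root. -/
noncomputable def highestIndex : ι := S.isHighest_highestRoot.1.choose

@[simp] theorem root_highestIndex : S.R.root S.highestIndex = S.highestRoot :=
  S.isHighest_highestRoot.1.choose_spec

theorem highestRoot_sub_mem (i : ι) : S.highestRoot - S.R.root i ∈ S.posCone := by
  obtain ⟨k, hk⟩ := S.isHighest_highestRoot.2 _ ⟨i, rfl⟩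
  rw [hk]
  exact sum_mem fun i _ => nsmul_mem (S.simpleRoot_mem_posCone i) _

theorem highestRoot_mem_posCone : S.highestRoot ∈ S.posCone := by
  rcases S.root_mem_or_neg_mem_posCone S.highestIndex with h | h
  · simpa using h
  · have h2 := add_mem (S.highestRoot_sub_mem (S.R.reflectionPerm S.highestIndex S.highestIndex)) h
    rw [S.R.root_reflectionPerm, S.R.reflection_apply_self, root_highestIndex] at h2
    simpa using h2

/-- The reflection in `ξ` sends `-α` to the root `kξ - α`, which lies below `ξ`. So `α - (k-1)ξ` is
in the cone, and adding `(k-2)ξ` puts `α - ξ` there too, while `ξ - α` is there already. -/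
theorem eq_highestRoot_of_two_le {i : ι} {k : ℤ}
    (hk : ⟪S.R.root i, S.R.coroot S.highestIndex⟫_ℝ = k) (h2 : 2 ≤ k) :
    i = S.highestIndex := by
  have h1 := S.highestRoot_sub_mem
    (S.R.reflectionPerm S.highestIndex (S.R.reflectionPerm i i))
  rw [S.R.root_reflectionPerm, S.R.root_reflectionPerm, S.R.reflection_apply_self, map_neg,
    reflection_apply, hk, root_highestIndex, Int.cast_smul_eq_zsmul] at h1
  obtain ⟨m, rfl⟩ : ∃ m : ℕ, k = m + 2 := ⟨(k - 2).toNat, by omega⟩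
  have h3 := add_mem h1 (nsmul_mem S.highestRoot_mem_posCone m)
  refine S.R.root.injective (S.eq_of_sub_mem_posCone ?_ ?_)
  · convert h3 using 1
    rw [root_highestIndex, add_smul, ← natCast_zsmul, two_smul]
    abel
  · rw [root_highestIndex]
    exact S.highestRoot_sub_mem i

theorem pairing_highest_cases (i : ι) :
    (∃ k : ℤ, ⟪S.R.root i, S.R.coroot S.highestIndex⟫_ℝ = k ∧ -1 ≤ k ∧ k ≤ 1) ∨
      i = S.highestIndex ∨ i = S.R.reflectionPerm S.highestIndex S.highestIndex := by
  obtain ⟨k, hk⟩ := S.exists_pairing_eq_intCast i S.highestIndex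
  rcases le_or_gt 2 k with h | h
  · exact Or.inr (Or.inl (S.eq_highestRoot_of_two_le hk h))
  rcases le_or_gt k (-2) with h' | h'
  · right; right
    have : S.R.reflectionPerm i i = S.highestIndex := by
      refine S.eq_highestRoot_of_two_le (k := -k) ?_ (by omega)
      rw [S.R.root_reflectionPerm, S.R.reflection_apply_self, inner_neg_left, hk]
      simp
    refine S.R.root.injective ?_
    rw [S.R.root_reflectionPerm, S.R.reflection_apply_self, ← this, S.R.root_reflectionPerm,
      S.R.reflection_apply_self, neg_neg]
  · exact Or.inl ⟨k, hk, by omega, by omega⟩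

end SimpleRoots

namespace SimpleRoots

variable {ι V : Type*} [NormedAddCommGroup V] [InnerProductSpace ℝ V] {n : ℕ}
  (S : SimpleRoots ι V n)

/-! ### The Weyl group -/

theorem simpleReflection_mem_W (i : Fin n) : S.simpleReflection i ∈ S.W :=
  Subgroup.subset_closure ⟨i, rfl⟩

theorem reflection_mem_W (i : ι) : S.R.reflection i ∈ S.W := by
  have := S.finite
  refine S.base.induction_reflect (p := fun i => S.R.reflection i ∈ S.W) i (fun i hi => ?_) (fun i hi => ?_) fun i j hi hj => ?_
  · rw [RootPairing.reflection_reflectionPerm]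
    exact mul_mem (mul_mem hi hi) hi
  · obtain ⟨m, hm⟩ := S.numbering.surjective ⟨i, hi⟩
    have := S.simpleReflection_mem_W m
    rwa [simpleReflection, hm] at this
  · have hj' : S.R.reflection j ∈ S.W := by
      obtain ⟨m, hm⟩ := S.numbering.surjective ⟨j, hj⟩
      have := S.simpleReflection_mem_W m
      rwa [simpleReflection, hm] at this
    rw [RootPairing.reflection_reflectionPerm]
    exact mul_mem (mul_mem hj' hi) hj'

variable {S} in
theorem inner_map_map {w : V ≃ₗ[ℝ] V} (hw : w ∈ S.W) (x y : V) : ⟪w x, w y⟫_ℝ = ⟪x, y⟫_ℝ := by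
  induction hw using Subgroup.closure_induction generalizing x y with
  | mem w hw =>
    obtain ⟨i, rfl⟩ := hw
    rw [simpleReflection, inner_reflection_left, S.R.reflection_same]
  | one => rfl
  | mul v w _ _ hv hw =>
    change ⟪v (w x), v (w y)⟫_ℝ = _
    rw [hv, hw]
  | inv w _ hw =>
    rw [← hw]
    change ⟪w (w.symm x), w (w.symm y)⟫_ℝ = _
    simp

variable {S} in
theorem norm_map {w : V ≃ₗ[ℝ] V} (hw : w ∈ S.W) (x : V) : ‖w x‖ = ‖x‖ := by
  rw [norm_eq_sqrt_real_inner, norm_eq_sqrt_real_inner, inner_map_map hw]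

variable {S} in
theorem inner_map_left {w : V ≃ₗ[ℝ] V} (hw : w ∈ S.W) (x y : V) :
    ⟪w x, y⟫_ℝ = ⟪x, w⁻¹ y⟫_ℝ := by
  rw [← inner_map_map (inv_mem hw) (w x)]
  change ⟪w.symm (w x), _⟫_ℝ = _
  rw [LinearEquiv.symm_apply_apply]

variable {S} in
theorem exists_map_root_eq {w : V ≃ₗ[ℝ] V} (hw : w ∈ S.W) (i : ι) :
    ∃ j, w (S.R.root i) = S.R.root j ∧ w (S.R.coroot i) = S.R.coroot j := by
  suffices h : ∃ j, w (S.R.root i) = S.R.root j by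
    obtain ⟨j, hj⟩ := h
    refine ⟨j, hj, ?_⟩
    rw [S.coroot_eq, S.coroot_eq, map_smul, hj, ← hj, inner_map_map hw]
  induction hw using Subgroup.closure_induction_left generalizing i with
  | one => exact ⟨i, rfl⟩
  | mul_left r hr w _ ih =>
    obtain ⟨m, rfl⟩ := hr
    obtain ⟨j, hj⟩ := ih i
    exact ⟨_, by rw [S.R.root_reflectionPerm, ← hj]; rfl⟩
  | inv_mul_cancel r hr w _ ih =>
    obtain ⟨m, rfl⟩ := hr
    obtain ⟨j, hj⟩ := ih i
    exact ⟨_, by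
      rw [show (S.simpleReflection m)⁻¹ = S.simpleReflection m from S.R.reflection_inv _,
        S.R.root_reflectionPerm, ← hj]; rfl⟩

theorem finite_W : Finite S.W := by
  have := S.finite
  choose f hf _ using fun (w : S.W) => exists_map_root_eq w.2
  refine Finite.of_injective f fun v w hvw => Subtype.ext (LinearEquiv.toLinearMap_injective ?_)
  refine S.rootBasis.ext fun i => ?_
  rw [rootBasis_apply, simpleRoot]
  change (v : V ≃ₗ[ℝ] V) _ = (w : V ≃ₗ[ℝ] V) _
  rw [hf, hf, hvw]

theorem coroot_mem_Qdual (i : ι) : S.R.coroot i ∈ S.Qdual := by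
  have h := S.base.coroot_mem_or_neg_mem i
  have hr : S.R.coroot '' S.base.support = Set.range S.simpleCoroot := S.dual.range_simpleRoot.symm
  have hle : AddSubmonoid.closure (Set.range S.simpleCoroot) ≤ S.Qdual.toAddSubmonoid :=
    AddSubmonoid.closure_le.2 AddSubgroup.subset_closure
  rw [hr] at h
  rcases h with h | h
  · exact hle h
  · exact neg_mem_iff.1 (hle h)

theorem exists_inner_eq_intCast_of_mem_Qdual {q : V} (hq : q ∈ S.Qdual) (i : ι) :
    ∃ k : ℤ, ⟪q, S.R.root i⟫_ℝ = k := by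
  induction hq using AddSubgroup.closure_induction with
  | mem x hx =>
    obtain ⟨j, rfl⟩ := hx
    rw [real_inner_comm]
    exact S.exists_pairing_eq_intCast i _
  | zero => exact ⟨0, by simp⟩
  | add x y _ _ hx hy =>
    obtain ⟨k, hk⟩ := hx
    obtain ⟨l, hl⟩ := hy
    exact ⟨k + l, by rw [inner_add_left, hk, hl]; push_cast; rfl⟩
  | neg x _ hx =>
    obtain ⟨k, hk⟩ := hx
    exact ⟨-k, by rw [inner_neg_left, hk]; push_cast; rfl⟩

/-! ### Affine reflections -/

/-- The affine form `⟨·, β⟩ - k` of a root `β` and an integer `k`. -/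
def affineForm (h : ι × ℤ) (x : V) : ℝ := ⟪x, S.R.root h.1⟫_ℝ - h.2

theorem affineForm_sub (h : ι × ℤ) (x y : V) :
    S.affineForm h (x - y) = S.affineForm h x - ⟪y, S.R.root h.1⟫_ℝ := by
  rw [affineForm, affineForm, inner_sub_left]
  ring

theorem inner_coroot_root_self (i : ι) : ⟪S.R.coroot i, S.R.root i⟫_ℝ = 2 := by
  rw [real_inner_comm, ← pairing_eq, RootPairing.pairing_same]

theorem inner_root_coroot_self (i : ι) : ⟪S.R.root i, S.R.coroot i⟫_ℝ = 2 := by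
  rw [← pairing_eq, RootPairing.pairing_same]

/-- The affine reflection `x ↦ x - (⟨x, β⟩ - k) β^∨`. -/
def affineReflection (h : ι × ℤ) : Equiv.Perm V :=
  Function.Involutive.toPerm (fun x => x - S.affineForm h x • S.R.coroot h.1) fun x => by
    simp only [affineForm_sub, real_inner_smul_left, inner_coroot_root_self, sub_smul, mul_smul,
      two_smul, smul_add]
    abel

theorem affineReflection_apply (h : ι × ℤ) (x : V) :
    S.affineReflection h x = x - S.affineForm h x • S.R.coroot h.1 := rfl

theorem affineReflection_apply' (h : ι × ℤ) (x : V) :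
    S.affineReflection h x = S.R.reflection h.1 x + (h.2 : ℝ) • S.R.coroot h.1 := by
  rw [affineReflection_apply, reflection_apply', affineForm, sub_smul]
  abel

theorem affineReflection_inv (h : ι × ℤ) :
    (S.affineReflection h)⁻¹ = S.affineReflection h := by
  ext x
  rfl

theorem affineReflection_mul_self (h : ι × ℤ) :
    S.affineReflection h * S.affineReflection h = 1 := by
  rw [mul_eq_one_iff_eq_inv, affineReflection_inv]

theorem affineForm_affineReflection_self (h : ι × ℤ) (x : V) :
    S.affineForm h (S.affineReflection h x) = -S.affineForm h x := by
  rw [affineReflection_apply, affineForm_sub, real_inner_smul_left, inner_coroot_root_self]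
  ring

/-- The image of the affine form `h` under the affine reflection of `t`. -/
noncomputable def affinePerm (t h : ι × ℤ) : ι × ℤ :=
  (S.R.reflectionPerm t.1 h.1, h.2 - t.2 * S.R.pairingIn ℤ h.1 t.1)

theorem affineForm_affineReflection (t h : ι × ℤ) (x : V) :
    S.affineForm h (S.affineReflection t x) = S.affineForm (S.affinePerm t h) x := by
  simp only [affineReflection_apply, affineForm_sub, affinePerm, real_inner_smul_left]
  simp only [affineForm, S.R.root_reflectionPerm, reflection_apply, inner_sub_right,
    real_inner_smul_right, Int.cast_sub, Int.cast_mul, pairingIn_cast,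
    real_inner_comm (S.R.root h.1) (S.R.coroot t.1)]
  ring

/-- Conjugating a reflection by a reflection gives a reflection. The exchange condition uses this to
push one through a word. -/
theorem affineReflection_mul (t h : ι × ℤ) :
    S.affineReflection h * S.affineReflection t =
      S.affineReflection t * S.affineReflection (S.affinePerm t h) := by
  ext x
  change S.affineReflection h (S.affineReflection t x) =
    S.affineReflection t (S.affineReflection (S.affinePerm t h) x)
  rw [affineReflection_apply S h, affineForm_affineReflection,
    affineReflection_apply S (S.affinePerm t h), affineReflection_apply' S t (_ - _), map_sub,
    map_smul]
  have : S.R.reflection t.1 (S.R.coroot (S.affinePerm t h).1) = S.R.coroot h.1 := by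
    rw [reflection_coroot]
    simp [affinePerm]
  rw [this, affineReflection_apply']
  abel

/-! ### The fundamental alcove -/

/-- The interior of the fundamental domain `F`. -/
def alcove : Set V := {a | (∀ i, 0 < ⟪a, S.simpleRoot i⟫_ℝ) ∧ ⟪a, S.highestRoot⟫_ℝ < 1}

theorem alcove_nonempty : S.alcove.Nonempty := by
  obtain ⟨ρ, hρ⟩ := S.exists_inner_simpleRoot_eq fun _ => 1
  have h1 := S.inner_nonneg_of_mem_posCone (x := ρ) (by simp [hρ]) S.highestRoot_mem_posCone
  refine ⟨(1 + ⟪ρ, S.highestRoot⟫_ℝ)⁻¹ • ρ, fun i => ?_, ?_⟩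
  · rw [real_inner_smul_left, hρ]
    positivity
  · rw [real_inner_smul_left, inv_mul_lt_one₀ (by positivity)]
    linarith

/-- The affine forms that define the fundamental domain `F`. -/
def walls : Set (ι × ℤ) :=
  insert (S.R.reflectionPerm S.highestIndex S.highestIndex, -1)
    (Set.range fun i => ((S.numbering i : ι), (0 : ℤ)))

theorem root_neg_highest :
    S.R.root (S.R.reflectionPerm S.highestIndex S.highestIndex) = -S.highestRoot := by
  rw [S.R.root_reflectionPerm, S.R.reflection_apply_self, root_highestIndex]

theorem coroot_neg_highest :
    S.R.coroot (S.R.reflectionPerm S.highestIndex S.highestIndex) =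
      -S.R.coroot S.highestIndex := by
  rw [S.R.coroot_reflectionPerm, S.R.coreflection_apply_self]

/-- The wall `(-ξ, -1)` has the affine form `1 - ⟨x, ξ⟩`. -/
theorem mem_F_iff {x : V} : x ∈ S.F ↔ ∀ h ∈ S.walls, 0 ≤ S.affineForm h x := by
  simp only [F, walls, Set.mem_ofPred_eq, Set.forall_mem_insert, Set.forall_mem_range, affineForm,
    root_neg_highest, simpleRoot, inner_neg_right]
  rw [and_comm]
  refine and_congr ?_ ?_
  · push_cast
    constructor <;> intro <;> linarith
  · simp

theorem mem_alcove_iff {x : V} : x ∈ S.alcove ↔ ∀ h ∈ S.walls, 0 < S.affineForm h x := by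
  simp only [alcove, walls, Set.mem_ofPred_eq, Set.forall_mem_insert, Set.forall_mem_range,
    affineForm, root_neg_highest, simpleRoot, inner_neg_right]
  rw [and_comm]
  refine and_congr ?_ ?_
  · push_cast
    constructor <;> intro <;> linarith
  · simp

variable {S}

theorem inner_mem_Icc_of_mem_F {x : V} (hx : x ∈ S.F) {i : ι} (hi : S.R.root i ∈ S.posCone) :
    0 ≤ ⟪x, S.R.root i⟫_ℝ ∧ ⟪x, S.R.root i⟫_ℝ ≤ 1 := by
  refine ⟨S.inner_nonneg_of_mem_posCone hx.1 hi, ?_⟩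
  have h1 := S.inner_nonneg_of_mem_posCone hx.1 (S.highestRoot_sub_mem i)
  have h2 := hx.2
  rw [inner_sub_right] at h1
  linarith

theorem inner_mem_Ioo_of_mem_alcove {x : V} (hx : x ∈ S.alcove) {i : ι}
    (hi : S.R.root i ∈ S.posCone) : 0 < ⟪x, S.R.root i⟫_ℝ ∧ ⟪x, S.R.root i⟫_ℝ < 1 := by
  refine ⟨S.inner_pos_of_mem_posCone hx.1 hi (S.R.ne_zero i), ?_⟩
  have h1 := S.inner_nonneg_of_mem_posCone (fun i => (hx.1 i).le) (S.highestRoot_sub_mem i)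
  have h2 := hx.2
  rw [inner_sub_right] at h1
  linarith

theorem alcove_subset_F : S.alcove ⊆ S.F :=
  fun _ hx => ⟨fun i => (hx.1 i).le, sub_nonneg.2 hx.2.le⟩

variable (S)

/-- A positive root lies below `ξ`, so its values are in `[0, 1]` on `F` and in `(0, 1)` on the
alcove; no integer level cuts through. -/
theorem affineForm_nonneg_or_nonpos (h : ι × ℤ) :
    ((∀ x ∈ S.F, 0 ≤ S.affineForm h x) ∧ ∀ c ∈ S.alcove, 0 < S.affineForm h c) ∨
      ((∀ x ∈ S.F, S.affineForm h x ≤ 0) ∧ ∀ c ∈ S.alcove, S.affineForm h c < 0) := by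
  obtain ⟨i, k⟩ := h
  simp only [affineForm]
  rcases S.root_mem_or_neg_mem_posCone i with hi | hi
  · rcases le_or_gt k 0 with hk | hk
    · have hk' : (k : ℝ) ≤ 0 := by exact_mod_cast hk
      exact Or.inl ⟨fun x hx => by linarith [(inner_mem_Icc_of_mem_F hx hi).1],
        fun x hx => by linarith [(inner_mem_Ioo_of_mem_alcove hx hi).1]⟩
    · have hk' : (1 : ℝ) ≤ k := by exact_mod_cast hk
      exact Or.inr ⟨fun x hx => by linarith [(inner_mem_Icc_of_mem_F hx hi).2],
        fun x hx => by linarith [(inner_mem_Ioo_of_mem_alcove hx hi).2]⟩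
  · have hr : S.R.root (S.R.reflectionPerm i i) = -S.R.root i := by
      rw [S.R.root_reflectionPerm, S.R.reflection_apply_self]
    rw [← hr] at hi
    have h1 := fun x hx => inner_mem_Icc_of_mem_F (S := S) (x := x) hx hi
    have h2 := fun x hx => inner_mem_Ioo_of_mem_alcove (S := S) (x := x) hx hi
    simp only [hr, inner_neg_right] at h1 h2
    rcases lt_or_ge k 0 with hk | hk
    · have hk' : (k : ℝ) ≤ -1 := by exact_mod_cast (by omega : k ≤ -1)
      exact Or.inl ⟨fun x hx => by linarith [h1 x hx], fun x hx => by linarith [h2 x hx]⟩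
    · have hk' : (0 : ℝ) ≤ k := by exact_mod_cast hk
      exact Or.inr ⟨fun x hx => by linarith [h1 x hx], fun x hx => by linarith [h2 x hx]⟩

theorem isPos_iff_mem_posCone (i : ι) : S.base.IsPos i ↔ S.R.root i ∈ S.posCone := by
  have := S.finite
  have key : ∀ i, S.base.IsPos i → S.R.root i ∈ S.posCone := by
    have hsimple : ∀ i ∈ S.base.support, S.R.root i ∈ S.posCone := fun i hi =>
      AddSubmonoid.subset_closure (by rw [range_simpleRoot]; exact ⟨i, hi, rfl⟩)
    intro i hi
    refine hi.induction_on_add hsimple fun i j k hk hi hj => ?_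
    rw [hk]
    exact add_mem hi (hsimple j hj)
  refine ⟨key i, fun h => ?_⟩
  rcases RootPairing.Base.IsPos.or_neg S.base i with h' | h'
  · exact h'
  · have h2 := key _ h'
    rw [RootPairing.indexNeg_neg, S.R.root_reflectionPerm, S.R.reflection_apply_self] at h2
    exact absurd (S.eq_zero_of_mem_posCone_of_neg_mem h h2) (S.R.ne_zero i)

/-- A simple reflection makes only its own simple root negative among the positive roots. -/
theorem reflection_mem_posCone {i : ι} (hi : S.R.root i ∈ S.posCone) (j : Fin n)
    (hij : i ≠ S.numbering j) : S.R.reflection (S.numbering j) (S.R.root i) ∈ S.posCone := by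
  have := S.finite
  rw [← S.R.root_reflectionPerm, ← isPos_iff_mem_posCone] at *
  exact hi.reflectionPerm (S.numbering j).2 hij

/-- A wall of the alcove is the only hyperplane that separates the alcove from its mirror image. -/
theorem eq_of_affineForm_affineReflection_neg {s h : ι × ℤ} (hs : s ∈ S.walls) {c : V}
    (hc : c ∈ S.alcove) (h1 : 0 < S.affineForm h c)
    (h2 : S.affineForm h (S.affineReflection s c) < 0) : h = s := by
  obtain ⟨i, k⟩ := h
  have hneg : ∀ i, S.R.root (S.R.reflectionPerm i i) = -S.R.root i := fun i => by
    rw [S.R.root_reflectionPerm, S.R.reflection_apply_self]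
  rcases hs with rfl | ⟨j, rfl⟩
  · have hξ := S.inner_pos_of_mem_posCone hc.1 S.highestRoot_mem_posCone
      (by rw [← root_highestIndex]; exact S.R.ne_zero _)
    have hξ1 := hc.2
    simp only [affineReflection_apply, affineForm_sub, coroot_neg_highest] at h2
    simp only [affineForm, root_neg_highest, inner_neg_right, smul_neg, inner_neg_left,
      real_inner_smul_left] at h1 h2
    rw [real_inner_comm (S.R.root i) (S.R.coroot S.highestIndex)] at h2
    push_cast at h2
    -- The affine reflection changes the value of `α` at `c` by `m (1 - ⟨c, ξ⟩)` with `m = ⟨α,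
    -- ξ^∨⟩`, and `k` must lie between the two values. For `m = 0` they agree. For `m = 1` the roots
    -- `α` and `ξ - α` are positive, for `m = -1` the roots `-α` and `α + ξ` are; either way `k`
    -- falls strictly between consecutive integers. For `α = ξ` one gets `1 < k < 1`, and `α = -ξ`
    -- leaves `k = -1`.
    rcases S.pairing_highest_cases i with ⟨m, hm, hm1, hm2⟩ | rfl | rfl
    · exfalso
      have hr : S.R.root (S.R.reflectionPerm S.highestIndex i) =
          S.R.root i - (m : ℝ) • S.highestRoot := by
        rw [S.R.root_reflectionPerm, reflection_apply, hm, root_highestIndex]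
      rw [hm] at h2
      obtain rfl | rfl | rfl : m = -1 ∨ m = 0 ∨ m = 1 := by omega
      · push_cast at h2 hr
        have hp : S.R.root (S.R.reflectionPerm S.highestIndex i) ∈ S.posCone := by
          have := S.highestRoot_sub_mem (S.R.reflectionPerm i i)
          rw [hneg] at this
          rw [hr]
          convert this using 1
          module
        have hp' : S.R.root (S.R.reflectionPerm i i) ∈ S.posCone := by
          have := S.highestRoot_sub_mem (S.R.reflectionPerm S.highestIndex i)
          rw [hr] at this
          rw [hneg]
          convert this using 1
          module
        have e1 := (inner_mem_Ioo_of_mem_alcove hc hp).1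
        have e2 := (inner_mem_Ioo_of_mem_alcove hc hp').1
        rw [hr, inner_sub_right, real_inner_smul_right] at e1
        rw [hneg, inner_neg_right] at e2
        have b1 : k < 0 := by exact_mod_cast (by linarith : (k : ℝ) < 0)
        have b2 : -1 < k := by exact_mod_cast (by linarith : (-1 : ℝ) < k)
        omega
      · push_cast at h2
        linarith
      · push_cast at h2 hr
        have hp : -S.R.root (S.R.reflectionPerm S.highestIndex i) ∈ S.posCone := by
          have := S.highestRoot_sub_mem i
          rw [hr]
          convert this using 1
          module
        rw [← hneg] at hp
        have hp' : S.R.root i ∈ S.posCone := by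
          have := S.highestRoot_sub_mem (S.R.reflectionPerm
            (S.R.reflectionPerm S.highestIndex i) (S.R.reflectionPerm S.highestIndex i))
          rw [hneg, hr] at this
          convert this using 1
          module
        have e1 := (inner_mem_Ioo_of_mem_alcove hc hp).2
        have e2 := (inner_mem_Ioo_of_mem_alcove hc hp').2
        rw [hneg, hr, inner_neg_right, inner_sub_right, real_inner_smul_right] at e1
        have b1 : k < 1 := by exact_mod_cast (by linarith : (k : ℝ) < 1)
        have b2 : 0 < k := by exact_mod_cast (by linarith : (0 : ℝ) < k)
        omega
    · exfalso
      rw [inner_root_coroot_self] at h2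
      rw [root_highestIndex] at h1 h2
      have b1 : k < 1 := by exact_mod_cast (by linarith : (k : ℝ) < 1)
      have b2 : 1 < k := by exact_mod_cast (by linarith : (1 : ℝ) < k)
      omega
    · rw [root_neg_highest, inner_neg_left S.highestRoot (S.R.coroot _), inner_neg_right,
        ← root_highestIndex, inner_root_coroot_self, root_highestIndex] at h2
      rw [root_neg_highest, inner_neg_right] at h1
      have b1 : k < 0 := by exact_mod_cast (by linarith : (k : ℝ) < 0)
      have b2 : -2 < k := by exact_mod_cast (by linarith : (-2 : ℝ) < k)
      rw [show k = -1 by omega]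
  · simp only [affineForm, affineReflection_apply', Int.cast_zero, zero_smul, add_zero,
      inner_reflection_left] at h1 h2
    -- The second value is that of the reflected root at `c`. Unless `α = ±α_j`, this root has the
    -- sign of `α`, so both values lie in the same interval `(0, 1)` or `(-1, 0)` and no integer
    -- separates them.
    rcases S.root_mem_or_neg_mem_posCone i with hi | hi
    · have e1 := (inner_mem_Ioo_of_mem_alcove hc hi).2
      have b1 : k < 1 := by exact_mod_cast (by linarith : (k : ℝ) < 1)
      have b1' : (k : ℝ) ≤ 0 := by exact_mod_cast (by omega : k ≤ 0)
      rcases eq_or_ne i (S.numbering j) with rfl | hne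
      · rw [S.R.reflection_apply_self, inner_neg_right] at h2
        have b2 : -1 < k := by exact_mod_cast (by linarith : (-1 : ℝ) < k)
        rw [show k = 0 by omega]
      · have hp := S.reflection_mem_posCone hi j hne
        rw [← S.R.root_reflectionPerm] at hp h2
        linarith [(inner_mem_Ioo_of_mem_alcove hc hp).1]
    · exfalso
      rw [← hneg] at hi
      have e1 := (inner_mem_Ioo_of_mem_alcove hc hi).1
      rw [hneg, inner_neg_right] at e1
      have b1 : k < 0 := by exact_mod_cast (by linarith : (k : ℝ) < 0)
      have b1' : (k : ℝ) ≤ -1 := by exact_mod_cast (by omega : k ≤ -1)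
      rcases eq_or_ne (S.R.reflectionPerm i i) (S.numbering j) with he | hne
      · have := congrArg (S.R.reflection (S.numbering j)) (hneg i)
        rw [he, S.R.reflection_apply_self, map_neg, neg_inj] at this
        rw [← this] at h2
        have e2 := hc.1 j
        rw [simpleRoot] at e2
        linarith
      · have hp := S.reflection_mem_posCone hi j hne
        rw [← S.R.root_reflectionPerm] at hp
        have e2 := (inner_mem_Ioo_of_mem_alcove hc hp).2
        rw [S.R.root_reflectionPerm, hneg, map_neg, inner_neg_right] at e2
        linarith

end SimpleRoots

namespace SimpleRoots

variable {ι V : Type*} [NormedAddCommGroup V] [InnerProductSpace ℝ V] {n : ℕ}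
  (S : SimpleRoots ι V n)

/-! ### Words in the reflections of the walls -/

/-- The product of a list of affine reflections. -/
def reflectionWord (L : List (ι × ℤ)) : Equiv.Perm V := (L.map S.affineReflection).prod

theorem reflectionWord_cons (t : ι × ℤ) (L : List (ι × ℤ)) :
    S.reflectionWord (t :: L) = S.affineReflection t * S.reflectionWord L := by
  simp [reflectionWord]

theorem exists_affineForm_reflectionWord (L : List (ι × ℤ)) (h : ι × ℤ) :
    ∃ h', ∀ x, S.affineForm h (S.reflectionWord L x) = S.affineForm h' x := by
  induction L generalizing h with
  | nil => exact ⟨h, fun _ => rfl⟩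
  | cons t L ih =>
    obtain ⟨h', hh'⟩ := ih (S.affinePerm t h)
    refine ⟨h', fun x => ?_⟩
    rw [reflectionWord_cons, Equiv.Perm.mul_apply, affineForm_affineReflection, hh']

/-- The exchange condition. -/
theorem exists_reflectionWord_eq_mul {L : List (ι × ℤ)} (hL : ∀ t ∈ L, t ∈ S.walls) {c : V}
    (hc : c ∈ S.alcove) {h : ι × ℤ} (h1 : 0 < S.affineForm h c)
    (h2 : S.affineForm h (S.reflectionWord L c) < 0) :
    ∃ L' : List (ι × ℤ), (∀ t ∈ L', t ∈ S.walls) ∧ L'.length < L.length ∧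
      S.affineReflection h * S.reflectionWord L = S.reflectionWord L' := by
  induction L generalizing h with
  | nil => exact absurd h1 (not_lt.2 (le_of_lt h2))
  | cons t L ih =>
    have hL' : ∀ t ∈ L, t ∈ S.walls := fun s hs => hL s (List.mem_cons_of_mem t hs)
    have ht : t ∈ S.walls := hL t List.mem_cons_self
    -- If the first letter alone already takes `c` across `h`, then `h` is that wall and the two
    -- reflections cancel. Otherwise `h` is carried past the first letter and the deletion happens
    -- further on.
    by_cases hneg : S.affineForm h (S.affineReflection t c) < 0
    · obtain rfl := S.eq_of_affineForm_affineReflection_neg ht hc h1 hneg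
      refine ⟨L, hL', by simp, ?_⟩
      rw [reflectionWord_cons, ← mul_assoc, affineReflection_mul_self, one_mul]
    · rw [affineForm_affineReflection] at hneg
      have h3 : 0 < S.affineForm (S.affinePerm t h) c := by
        rcases S.affineForm_nonneg_or_nonpos (S.affinePerm t h) with h' | h'
        · exact h'.2 c hc
        · exact absurd (h'.2 c hc) hneg
      rw [reflectionWord_cons, Equiv.Perm.mul_apply, affineForm_affineReflection] at h2
      obtain ⟨L', hL'', hlen, heq⟩ := ih hL' h3 h2
      refine ⟨t :: L', List.forall_mem_cons.2 ⟨ht, hL''⟩, by simpa using hlen, ?_⟩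
      rw [reflectionWord_cons, reflectionWord_cons, ← mul_assoc, affineReflection_mul, mul_assoc,
        heq]

/-- Induction on the length. Pull the form of the first letter `s` back along the word. If the
result is positive on the alcove, the remaining word takes `c` across `s`, and exchange gives a
shorter word for the same map. If it is non-positive on `F`, the image of `a`, lying in `F`, is on
the wall of `s`; then `s` acts trivially and can be dropped. -/
theorem reflectionWord_apply_eq_self {L : List (ι × ℤ)} (hL : ∀ t ∈ L, t ∈ S.walls) {a : V}
    (ha : a ∈ S.F) (hLa : S.reflectionWord L a ∈ S.F) : S.reflectionWord L a = a := by
  obtain ⟨c, hc⟩ := S.alcove_nonempty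
  induction hm : L.length using Nat.strong_induction_on generalizing L with
  | _ m ih =>
  subst hm
  match L with
  | [] => rfl
  | s :: L =>
    have hs : s ∈ S.walls := hL s List.mem_cons_self
    have hL' : ∀ t ∈ L, t ∈ S.walls := fun t ht => hL t (List.mem_cons_of_mem s ht)
    obtain ⟨h', hh'⟩ := S.exists_affineForm_reflectionWord (s :: L) s
    rcases S.affineForm_nonneg_or_nonpos h' with h1 | h1
    · have h2 := h1.2 c hc
      rw [← hh', reflectionWord_cons, Equiv.Perm.mul_apply, affineForm_affineReflection_self,
        neg_pos] at h2
      obtain ⟨L', hL'', hlen, heq⟩ :=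
        S.exists_reflectionWord_eq_mul hL' hc (S.mem_alcove_iff.1 hc s hs) h2
      rw [reflectionWord_cons, heq] at hLa ⊢
      exact ih _ (hlen.trans (by simp)) hL'' hLa rfl
    · have h2 := h1.1 a ha
      rw [← hh'] at h2
      have h3 := le_antisymm h2 (S.mem_F_iff.1 hLa s hs)
      rw [reflectionWord_cons, Equiv.Perm.mul_apply, affineForm_affineReflection_self,
        neg_eq_zero] at h3
      have h4 : S.reflectionWord (s :: L) a = S.reflectionWord L a := by
        rw [reflectionWord_cons, Equiv.Perm.mul_apply, affineReflection_apply, h3, zero_smul,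
          sub_zero]
      rw [h4] at hLa ⊢
      exact ih _ (by simp) hL' hLa rfl

/-- The group generated by the reflections of the walls of the fundamental alcove. -/
def wallGroup : Subgroup (Equiv.Perm V) := Subgroup.closure (S.affineReflection '' S.walls)

theorem affineReflection_mem_wallGroup {h : ι × ℤ} (hh : h ∈ S.walls) :
    S.affineReflection h ∈ S.wallGroup :=
  Subgroup.subset_closure ⟨h, hh, rfl⟩

theorem exists_eq_reflectionWord {g : Equiv.Perm V} (hg : g ∈ S.wallGroup) :
    ∃ L : List (ι × ℤ), (∀ t ∈ L, t ∈ S.walls) ∧ g = S.reflectionWord L := by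
  induction hg using Subgroup.closure_induction_left with
  | one => exact ⟨[], by simp, rfl⟩
  | mul_left r hr g _ ih =>
    obtain ⟨t, ht, rfl⟩ := hr
    obtain ⟨L, hL, rfl⟩ := ih
    exact ⟨t :: L, List.forall_mem_cons.2 ⟨ht, hL⟩, (S.reflectionWord_cons t L).symm⟩
  | inv_mul_cancel r hr g _ ih =>
    obtain ⟨t, ht, rfl⟩ := hr
    obtain ⟨L, hL, rfl⟩ := ih
    exact ⟨t :: L, List.forall_mem_cons.2 ⟨ht, hL⟩, by rw [affineReflection_inv, reflectionWord_cons]⟩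

theorem toPerm_mem_wallGroup {w : V ≃ₗ[ℝ] V} (hw : w ∈ S.W) :
    MulAction.toPermHom (V ≃ₗ[ℝ] V) V w ∈ S.wallGroup := by
  have : S.W ≤ S.wallGroup.comap (MulAction.toPermHom (V ≃ₗ[ℝ] V) V) := by
    refine (Subgroup.closure_le _).2 ?_
    rintro _ ⟨i, rfl⟩
    have h : MulAction.toPermHom (V ≃ₗ[ℝ] V) V (S.simpleReflection i) =
        S.affineReflection (S.numbering i, 0) := by
      ext x
      rw [affineReflection_apply']
      simp [simpleReflection]
    change _ ∈ S.wallGroup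
    rw [h]
    exact S.affineReflection_mem_wallGroup (Set.mem_insert_of_mem _ ⟨i, rfl⟩)
  exact this hw

/-- The vectors of the translations in `wallGroup`. -/
def translationLattice : AddSubgroup V where
  carrier := {q | Equiv.addRight q ∈ S.wallGroup}
  zero_mem' := by
    change _ ∈ S.wallGroup
    convert one_mem S.wallGroup
    ext; simp
  add_mem' {x y} hx hy := by
    change _ ∈ S.wallGroup
    change Equiv.addRight x ∈ S.wallGroup at hx
    change Equiv.addRight y ∈ S.wallGroup at hy
    convert mul_mem hy hx using 1
    ext; simp [add_assoc]
  neg_mem' {x} hx := by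
    change _ ∈ S.wallGroup
    change Equiv.addRight x ∈ S.wallGroup at hx
    convert inv_mem hx using 1
    ext; simp

theorem map_mem_translationLattice {w : V ≃ₗ[ℝ] V} (hw : w ∈ S.W) {q : V}
    (hq : q ∈ S.translationLattice) : w q ∈ S.translationLattice := by
  have h := S.toPerm_mem_wallGroup hw
  have h2 := mul_mem (mul_mem h hq) (inv_mem h)
  change _ ∈ S.wallGroup
  convert h2 using 1
  ext x
  change x + w q = w (w.symm x + q)
  simp

/-- The reflections in the parallel hyperplanes `⟨x, ξ⟩ = 1` and `⟨x, ξ⟩ = 0` compose to the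
translation by `ξ^∨`. -/
theorem coroot_highest_mem_translationLattice :
    S.R.coroot S.highestIndex ∈ S.translationLattice := by
  have h1 := S.affineReflection_mem_wallGroup (Set.mem_insert _ _)
  have h2 := S.toPerm_mem_wallGroup (S.reflection_mem_W S.highestIndex)
  have h3 := mul_mem h1 h2
  change _ ∈ S.wallGroup
  convert h3 using 1
  ext x
  change x + S.R.coroot S.highestIndex = S.affineReflection _ (S.R.reflection S.highestIndex x)
  simp only [affineReflection_apply, affineForm, root_neg_highest, coroot_neg_highest,
    inner_neg_right]
  rw [← root_highestIndex, inner_reflection_left, S.R.reflection_apply_self, reflection_apply',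
    inner_neg_right]
  push_cast
  module

/-- By irreducibility the orbit of `ξ` spans `V`, so no root is orthogonal to all of it. -/
theorem exists_inner_map_highestRoot_ne_zero (i : ι) :
    ∃ w ∈ S.W, ⟪S.R.root i, w S.highestRoot⟫_ℝ ≠ 0 := by
  by_contra! h
  set q : Submodule ℝ V := Submodule.span ℝ {x | ∃ w ∈ S.W, x = w S.highestRoot} with hq
  have htop : q = ⊤ := by
    refine RootPairing.IsIrreducible.eq_top_of_invtSubmodule_reflection (P := S.R) q
      (fun j => ?_) fun hbot => ?_
    · rw [Module.End.mem_invtSubmodule, hq, Submodule.span_le]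
      rintro _ ⟨w, hw, rfl⟩
      exact Submodule.subset_span ⟨S.R.reflection j * w, mul_mem (S.reflection_mem_W j) hw, rfl⟩
    · have : S.highestRoot ∈ q := Submodule.subset_span ⟨1, one_mem _, rfl⟩
      rw [hbot, Submodule.mem_bot, ← root_highestIndex] at this
      exact S.R.ne_zero _ this
  have hz : ∀ x ∈ q, ⟪S.R.root i, x⟫_ℝ = 0 := by
    intro x hx
    refine Submodule.span_induction ?_ ?_ ?_ ?_ hx
    · rintro _ ⟨w, hw, rfl⟩
      exact h w hw
    · simp
    · intro x y _ _ h1 h2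
      rw [inner_add_right, h1, h2, add_zero]
    · intro c x _ h1
      rw [real_inner_smul_right, h1, mul_zero]
  exact (S.inner_root_self_pos i).ne' (hz _ (htop ▸ Submodule.mem_top))

/-- Move the root by `W` to a root `β` not orthogonal to `ξ`. Either `β = ±ξ`, or `⟨β, ξ^∨⟩ = ±1`,
and then `ξ^∨` and its image under the reflection in `β` differ by a positive integer multiple of
`β^∨` or `-β^∨`. -/
theorem coroot_mem_translationLattice (i : ι) : S.R.coroot i ∈ S.translationLattice := by
  have hθ := S.coroot_highest_mem_translationLattice
  obtain ⟨w, hw, hne⟩ := S.exists_inner_map_highestRoot_ne_zero i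
  obtain ⟨j, hj, hj'⟩ := exists_map_root_eq (inv_mem hw) i
  suffices h : S.R.coroot j ∈ S.translationLattice by
    have := S.map_mem_translationLattice hw h
    rwa [← hj', show w (w⁻¹ (S.R.coroot i)) = S.R.coroot i from w.apply_symm_apply _] at this
  rw [real_inner_comm, inner_map_left hw, hj, real_inner_comm] at hne
  rcases S.pairing_highest_cases j with ⟨k, hk, h1, h2⟩ | rfl | rfl
  · have h3 := sub_mem hθ (S.map_mem_translationLattice (S.reflection_mem_W j) hθ)
    rw [reflection_apply', sub_sub_cancel, real_inner_comm, hk, Int.cast_smul_eq_zsmul] at h3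
    have hk0 : k ≠ 0 := by
      rintro rfl
      rw [inner_coroot, root_highestIndex, Int.cast_zero, mul_eq_zero] at hk
      rcases hk with hk | hk
      · rw [← root_highestIndex] at hk
        exact (div_pos two_pos (S.inner_root_self_pos _)).ne' hk
      · exact hne hk
    -- Only these values make the multiple `k β^∨` yield `β^∨` itself.
    obtain rfl | rfl : k = 1 ∨ k = -1 := by omega
    · simpa using h3
    · simpa using h3
  · exact hθ
  · rw [coroot_neg_highest]
    exact neg_mem hθ

theorem Qdual_le_translationLattice : S.Qdual ≤ S.translationLattice := by
  refine (AddSubgroup.closure_le _).2 ?_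
  rintro _ ⟨i, rfl⟩
  exact S.coroot_mem_translationLattice _

variable {S}

/-- Two points of `F` in the same orbit of the affine Weyl group are equal. -/
theorem map_add_eq_self_of_mem_F {w : V ≃ₗ[ℝ] V} (hw : w ∈ S.W) {q : V} (hq : q ∈ S.Qdual) {a : V}
    (ha : a ∈ S.F) (h : w a + q ∈ S.F) : w a + q = a := by
  obtain ⟨L, hL, heq⟩ := S.exists_eq_reflectionWord
    (mul_mem (S.Qdual_le_translationLattice hq) (S.toPerm_mem_wallGroup hw))
  have h1 : S.reflectionWord L a = w a + q := by
    rw [← heq]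
    rfl
  rw [← h1] at h ⊢
  exact S.reflectionWord_apply_eq_self hL ha h

variable (S)

/-! ### Every orbit meets the fundamental domain -/

theorem finite_Qdual_inter_closedBall (r : ℝ) :
    {q | q ∈ S.Qdual ∧ ‖q‖ ≤ r}.Finite := by
  have := S.finiteDimensional
  have := FiniteDimensional.proper ℝ V
  refine (ZSpan.setFinite_inter S.corootBasis (s := Metric.closedBall 0 r)
    Metric.isBounded_closedBall).subset ?_
  rintro q ⟨hq, hr⟩
  refine ⟨by simpa using hr, ?_⟩
  have : Set.range S.corootBasis = Set.range S.simpleCoroot :=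
    congrArg Set.range (funext S.corootBasis_apply)
  rw [this]
  change q ∈ Submodule.span ℤ _
  rw [← Submodule.mem_toAddSubgroup, Submodule.span_int_eq_addSubgroupClosure]
  exact hq

/-- With `t = 2 / ⟨β, β⟩`, the squared distance changes by `2t` times the product of the two values
of the form, which have opposite signs. -/
theorem norm_affineReflection_sub_lt {h : ι × ℤ} {x c : V} (hx : S.affineForm h x < 0)
    (hc : 0 < S.affineForm h c) : ‖S.affineReflection h x - c‖ < ‖x - c‖ := by
  have ht : 0 < 2 / ⟪S.R.root h.1, S.R.root h.1⟫_ℝ := div_pos two_pos (S.inner_root_self_pos _)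
  refine lt_of_pow_lt_pow_left₀ 2 (norm_nonneg _) ?_
  rw [affineReflection_apply, sub_right_comm, norm_sub_sq_real, norm_smul, mul_pow,
    ← real_inner_self_eq_norm_sq (S.R.coroot h.1), real_inner_smul_right, inner_coroot, inner_coroot,
    inner_coroot_root_self, inner_sub_left]
  have h1 : ⟪x, S.R.root h.1⟫_ℝ - ⟪c, S.R.root h.1⟫_ℝ =
    S.affineForm h x - S.affineForm h c := by
    rw [affineForm, affineForm]
    ring
  rw [h1, Real.norm_eq_abs, sq_abs]
  have := mul_pos ht (mul_pos_of_neg_of_neg hx (neg_neg_of_pos hc))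
  nlinarith

/-- Finitely many points of the orbit are at most as far from an alcove point `c` as `x` is. The
nearest lies in `F`, since reflecting in a violated wall would bring it nearer. -/
theorem exists_map_add_mem_F (x : V) : ∃ w ∈ S.W, ∃ q ∈ S.Qdual, w x + q ∈ S.F := by
  obtain ⟨c, hc⟩ := S.alcove_nonempty
  have := S.finite_W
  set O : Set V := {y | (∃ w ∈ S.W, ∃ q ∈ S.Qdual, y = w x + q) ∧ ‖y - c‖ ≤ ‖x - c‖} with hO
  have hfin : O.Finite := by
    refine (Set.finite_iUnion fun w : S.W =>
      (S.finite_Qdual_inter_closedBall (‖x - c‖ + ‖c‖ + ‖x‖)).image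
        fun q => (w : V ≃ₗ[ℝ] V) x + q).subset ?_
    rintro _ ⟨⟨w, hw, q, hq, rfl⟩, hle⟩
    refine Set.mem_iUnion.2 ⟨⟨w, hw⟩, q, ⟨hq, ?_⟩, rfl⟩
    have e : q = (w x + q - c) + c - w x := by abel
    calc ‖q‖ = ‖(w x + q - c) + c - w x‖ := by rw [← e]
      _ ≤ ‖(w x + q - c) + c‖ + ‖w x‖ := norm_sub_le _ _
      _ ≤ ‖w x + q - c‖ + ‖c‖ + ‖w x‖ := by gcongr; exact norm_add_le _ _
      _ ≤ ‖x - c‖ + ‖c‖ + ‖x‖ := by rw [norm_map hw]; gcongr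
  obtain ⟨y, ⟨⟨w, hw, q, hq, rfl⟩, hle⟩, hmin⟩ := Set.exists_min_image O (fun y => ‖y - c‖) hfin
    ⟨x, ⟨1, one_mem _, 0, zero_mem _, by simp⟩, le_rfl⟩
  refine ⟨w, hw, q, hq, ?_⟩
  rw [mem_F_iff]
  intro h hh
  by_contra! hneg
  have hlt := S.norm_affineReflection_sub_lt hneg (S.mem_alcove_iff.1 hc h hh)
  refine absurd (hmin (S.affineReflection h (w x + q)) ⟨⟨S.R.reflection h.1 * w,
    mul_mem (S.reflection_mem_W _) hw, S.R.reflection h.1 q + h.2 • S.R.coroot h.1,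
    add_mem (S.Qdual_stable _ (S.reflection_mem_W _) _ hq)
      (zsmul_mem (S.coroot_mem_Qdual _) _), ?_⟩, hlt.le.trans hle⟩) (not_le.2 hlt)
  rw [affineReflection_apply', map_add, Int.cast_smul_eq_zsmul, add_assoc]
  rfl

variable {S}

/-- An affine map that permutes the affine forms and maps a point of the alcove into `F` maps `F`
into itself. -/
theorem map_add_mem_F {w : V ≃ₗ[ℝ] V} (hw : w ∈ S.W) {p : V}
    (hp : ∀ i, ∃ k : ℤ, ⟪p, S.R.root i⟫_ℝ = k) {c : V} (hc : c ∈ S.alcove) (hwc : w c + p ∈ S.F)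
    {x : V} (hx : x ∈ S.F) : w x + p ∈ S.F := by
  rw [mem_F_iff] at hwc ⊢
  intro h hh
  obtain ⟨k, hk⟩ := hp h.1
  obtain ⟨j, hj, -⟩ := exists_map_root_eq (inv_mem hw) h.1
  have key : ∀ y, S.affineForm h (w y + p) = S.affineForm (j, h.2 - k) y := fun y => by
    simp only [affineForm]
    rw [inner_add_left, inner_map_left hw, hj, hk]
    push_cast
    ring
  have h1 := hwc h hh
  rw [key] at h1 ⊢
  rcases S.affineForm_nonneg_or_nonpos (j, h.2 - k) with h2 | h2
  · exact h2.1 x hx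
  · exact absurd (h2.2 c hc) (not_lt.2 h1)

theorem map_add_mem_alcove {w : V ≃ₗ[ℝ] V} (hw : w ∈ S.W) {p : V}
    (hp : ∀ i, ∃ k : ℤ, ⟪p, S.R.root i⟫_ℝ = k) {c : V} (hc : c ∈ S.alcove) (hwc : w c + p ∈ S.F) :
    w c + p ∈ S.alcove := by
  rw [mem_F_iff] at hwc
  rw [mem_alcove_iff]
  intro h hh
  obtain ⟨k, hk⟩ := hp h.1
  obtain ⟨j, hj, -⟩ := exists_map_root_eq (inv_mem hw) h.1
  have key : S.affineForm h (w c + p) = S.affineForm (j, h.2 - k) c := by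
    simp only [affineForm]
    rw [inner_add_left, inner_map_left hw, hj, hk]
    push_cast
    ring
  have h1 := hwc h hh
  rw [key] at h1 ⊢
  rcases S.affineForm_nonneg_or_nonpos (j, h.2 - k) with h2 | h2
  · exact h2.2 c hc
  · exact absurd (h2.2 c hc) (not_lt.2 h1)

/-- An element of the extended affine Weyl group differs from one that preserves `F` by an element
of the affine Weyl group. -/
theorem exists_image_F_eq {w : V ≃ₗ[ℝ] V} (hw : w ∈ S.W) {p : V}
    (hp : ∀ i, ∃ k : ℤ, ⟪p, S.R.root i⟫_ℝ = k) :
    ∃ v ∈ S.W, ∃ q ∈ S.Qdual, (fun x => v (w x + p) + q) '' S.F = S.F := by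
  obtain ⟨c, hc⟩ := S.alcove_nonempty
  -- Bringing the image of a single alcove point back into `F` suffices: the composite then maps `F`
  -- into `F`, and so does its inverse, because the image point is again in the alcove.
  obtain ⟨v, hv, q, hq, hmem⟩ := S.exists_map_add_mem_F (w c + p)
  refine ⟨v, hv, q, hq, ?_⟩
  set u : V ≃ₗ[ℝ] V := v * w with hu
  have huW : u ∈ S.W := mul_mem hv hw
  set r : V := v p + q with hr
  have hform : ∀ x, v (w x + p) + q = u x + r := fun x => by
    rw [map_add, add_assoc]
    rfl
  have hrint : ∀ i, ∃ k : ℤ, ⟪r, S.R.root i⟫_ℝ = k := fun i => by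
    obtain ⟨j, hj, -⟩ := exists_map_root_eq (inv_mem hv) i
    obtain ⟨k, hk⟩ := hp j
    obtain ⟨l, hl⟩ := S.exists_inner_eq_intCast_of_mem_Qdual hq i
    exact ⟨k + l, by rw [hr, inner_add_left, inner_map_left hv, hj, hk, hl]; push_cast; rfl⟩
  have hrint' : ∀ i, ∃ k : ℤ, ⟪-(u⁻¹ r), S.R.root i⟫_ℝ = k := fun i => by
    obtain ⟨j, hj, -⟩ := exists_map_root_eq (inv_mem (inv_mem huW)) i
    obtain ⟨k, hk⟩ := hrint j
    exact ⟨-k, by rw [inner_neg_left, inner_map_left (inv_mem huW), hj, hk]; push_cast; rfl⟩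
  simp only [hform] at hmem ⊢
  have hcancel : ∀ x, u⁻¹ (u x) = x := u.symm_apply_apply
  refine Set.Subset.antisymm ?_ fun y hy => ⟨u⁻¹ y + -(u⁻¹ r), ?_, ?_⟩
  · rintro _ ⟨x, hx, rfl⟩
    exact map_add_mem_F huW hrint hc hmem hx
  · refine map_add_mem_F (inv_mem huW) hrint' (map_add_mem_alcove huW hrint hc hmem) ?_ hy
    rw [map_add, hcancel, add_neg_cancel_right]
    exact alcove_subset_F hc
  · simp

end SimpleRoots

/-! ### Elements and stabilizers of the semidirect products -/

namespace LatticeSemidirect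

variable {V : Type*} [AddCommGroup V] [Module ℝ V] {W : Subgroup (V ≃ₗ[ℝ] V)}
    {L : AddSubgroup V} {h : ∀ w ∈ W, ∀ x ∈ L, w x ∈ L}

/-- The element `T(p) w` of the semidirect product. -/
def mk (p : L) (w : W) : LatticeSemidirect W L h :=
  (⟨Multiplicative.ofAdd p, w⟩ : Multiplicative L ⋊[latticeAction W L h] W)

@[simp] theorem retraction_mk (p : L) (w : W) : retraction (mk p w : LatticeSemidirect W L h) = w :=
  rfl

@[simp] theorem trans_mk (p : L) (w : W) : trans (mk p w : LatticeSemidirect W L h) = p := rfl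

theorem ext {g g' : LatticeSemidirect W L h} (h1 : trans g = trans g')
    (h2 : retraction g = retraction g') : g = g' :=
  SemidirectProduct.ext h1 h2

/-- The stabilizer of `x` consists of the linear parts `w` with `x - w x` in the lattice. -/
def stabilizerEquiv (x : V) : MulAction.stabilizer (LatticeSemidirect W L h) x ≃
    {w : W // x - (w : V ≃ₗ[ℝ] V) x ∈ L} where
  toFun g := ⟨retraction g.1, by
    have := MulAction.mem_stabilizer_iff.1 g.2
    rw [smul_def] at this
    nth_rewrite 1 [← this]
    simp⟩
  invFun w := ⟨mk ⟨_, w.2⟩ w.1, by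
    rw [MulAction.mem_stabilizer_iff, smul_def]
    simp⟩
  left_inv g := by
    have := MulAction.mem_stabilizer_iff.1 g.2
    rw [smul_def, ← eq_sub_iff_add_eq'] at this
    exact Subtype.ext (ext (Subtype.ext this.symm) rfl)
  right_inv w := rfl

end LatticeSemidirect

/-! ### The dual system and the domain `F_P` -/

namespace SimpleRoots

variable {ι V : Type*} [NormedAddCommGroup V] [InnerProductSpace ℝ V] {n : ℕ}
  (S : SimpleRoots ι V n)

theorem inner_mem_int {p q : V} (hp : p ∈ S.weightLattice) (hq : q ∈ S.Qdual) :
    ∃ k : ℤ, ⟪p, q⟫_ℝ = k := by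
  induction hq using AddSubgroup.closure_induction with
  | mem x hx =>
    obtain ⟨j, rfl⟩ := hx
    exact hp j
  | zero => exact ⟨0, by simp⟩
  | add x y _ _ hx hy =>
    obtain ⟨k, hk⟩ := hx
    obtain ⟨l, hl⟩ := hy
    exact ⟨k + l, by rw [inner_add_right, hk, hl]; push_cast; rfl⟩
  | neg x _ hx =>
    obtain ⟨k, hk⟩ := hx
    exact ⟨-k, by rw [inner_neg_right, hk]; push_cast; rfl⟩

theorem dual_W : S.dual.W = S.W := by
  have : S.dual.simpleReflection = S.simpleReflection := by
    funext i
    ext x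
    change S.R.coreflection (S.numbering i) x = S.R.reflection (S.numbering i) x
    rw [RootPairing.coreflection_apply, reflection_apply', real_inner_comm, ← S.pairing_eq_inner]
  rw [W, W, this]

theorem dual_F : S.dual.F = S.FQ := by
  ext x
  simp only [F, FQ, kac, Set.mem_ofPred_eq, Fin.forall_fin_succ, Fin.cons_zero, Fin.cons_succ]
  exact and_comm

theorem dual_Qdual_le : S.dual.Qdual ≤ S.weightLattice := by
  refine (AddSubgroup.closure_le _).2 ?_
  rintro _ ⟨i, rfl⟩ j
  exact S.cartan_int i j

theorem kac_injective : Function.Injective S.kac := by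
  intro x y h
  refine InnerProductSpace.ext_inner_right_basis S.corootBasis fun i => ?_
  simpa [kac] using congrFun h i.succ

/-- Compose `T(p) w` with a dual affine element `T(q) v` so that the result `γ` lies in `Γ`. Then `γ
b = v b' + q` is in `F_Q` together with `b'`, hence equals `b'`, and the maximality of `b` in its
`Γ`-orbit applies. -/
theorem kac_le_of_mem_FP {b b' : V} (hb : b ∈ S.FP) (hb' : b' ∈ S.FP) {w : V ≃ₗ[ℝ] V}
    (hw : w ∈ S.W) {p : V} (hp : p ∈ S.weightLattice) (h : b' = w b + p) :
    toLex (S.kac b') ≤ toLex (S.kac b) := by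
  obtain ⟨v, hv, q, hq, himage⟩ := exists_image_F_eq (S := S.dual) (w := w) (by rwa [dual_W])
    (p := p) fun i => S.inner_mem_int hp (S.coroot_mem_Qdual i)
  have hv' : v ∈ S.W := by rwa [dual_W] at hv
  set γ : S.WaffP := LatticeSemidirect.mk ⟨v p + q, add_mem (S.weightLattice_stable v hv' p hp)
    (S.dual_Qdual_le hq)⟩ ⟨v * w, mul_mem hv' hw⟩ with hγ
  have hsmul : ∀ x, γ • x = v (w x + p) + q := fun x => by
    rw [map_add, add_assoc]
    rfl
  have hΓ : γ ∈ S.Γ := by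
    change (fun b : V => γ • b) '' S.FQ = S.FQ
    simp only [hsmul]
    rwa [dual_F] at himage
  have hmem : v b' + q ∈ S.dual.F := by
    rw [← himage, h]
    exact ⟨b, S.dual_F ▸ hb.1, rfl⟩
  have hfix := map_add_eq_self_of_mem_F hv hq (S.dual_F ▸ hb'.1) hmem
  have := hb.2 γ hΓ
  rwa [hsmul, ← h, hfix] at this

theorem eq_of_mem_FP {b b' : V} (hb : b ∈ S.FP) (hb' : b' ∈ S.FP) {w : V ≃ₗ[ℝ] V}
    (hw : w ∈ S.W) {p : V} (hp : p ∈ S.weightLattice) (h : b' = w b + p) : b = b' := by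
  have h1 := S.kac_le_of_mem_FP hb hb' hw hp h
  have h2 := S.kac_le_of_mem_FP hb' hb (inv_mem hw)
    (neg_mem (S.weightLattice_stable _ (inv_mem hw) p hp)) (by
      rw [h, map_add, add_neg_cancel_right]
      exact (w.symm_apply_apply b).symm)
  exact S.kac_injective (toLex.injective (le_antisymm h2 h1))

end SimpleRoots

namespace SimpleRoots

variable {ι V : Type*} [NormedAddCommGroup V] [InnerProductSpace ℝ V] {n : ℕ}
  (S : SimpleRoots ι V n)

/-! ### Exponentials -/

/-- The exponential `e^{2 π i t}`. -/
noncomputable def expTurn (t : ℝ) : ℂ := Complex.exp (2 * Real.pi * Complex.I * t)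

theorem expTurn_add (s t : ℝ) : expTurn (s + t) = expTurn s * expTurn t := by
  rw [expTurn, expTurn, expTurn, ← Complex.exp_add, Complex.ofReal_add, mul_add]

theorem expTurn_intCast (k : ℤ) : expTurn k = 1 := by
  rw [expTurn, Complex.exp_eq_one_iff]
  exact ⟨k, by push_cast; ring⟩

theorem star_expTurn (t : ℝ) : starRingEnd ℂ (expTurn t) = expTurn (-t) := by
  rw [expTurn, expTurn, ← Complex.exp_conj]
  simp [map_ofNat (starRingEnd ℂ) 2]

theorem expTurn_sum {α : Type*} (s : Finset α) (f : α → ℝ) :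
    expTurn (∑ i ∈ s, f i) = ∏ i ∈ s, expTurn (f i) := by
  simp only [expTurn, ← Complex.exp_sum, Complex.ofReal_sum, Finset.mul_sum]

/-! ### The refined lattice modulo the dual root lattice -/

theorem mem_Qdual_iff {x : V} : x ∈ S.Qdual ↔ ∀ i, ∃ k : ℤ, S.corootBasis.repr x i = k := by
  have h1 : S.Qdual = (Submodule.span ℤ (Set.range S.corootBasis)).toAddSubgroup := by
    rw [Submodule.span_int_eq_addSubgroupClosure,
      show Set.range S.corootBasis = Set.range S.simpleCoroot from
        congrArg Set.range (funext S.corootBasis_apply)]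
    rfl
  rw [h1, Submodule.mem_toAddSubgroup, Module.Basis.mem_span_iff_repr_mem]
  simp [eq_comm]

/-- The lattice `(1/M) Q^∨`. -/
def refinedLattice (M : ℕ) : Set V := {x | ∃ q ∈ S.Qdual, x = (M : ℝ)⁻¹ • q}

theorem map_add_mem_refinedLattice {M : ℕ} (hM : 0 < M) {x : V} (hx : x ∈ S.refinedLattice M)
    {w : V ≃ₗ[ℝ] V} (hw : w ∈ S.W) {q : V} (hq : q ∈ S.Qdual) :
    w x + q ∈ S.refinedLattice M := by
  obtain ⟨r, hr, rfl⟩ := hx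
  refine ⟨w r + M • q, add_mem (S.Qdual_stable w hw r hr) (nsmul_mem hq M), ?_⟩
  rw [map_smul, smul_add, ← Nat.cast_smul_eq_nsmul ℝ, smul_smul, inv_mul_cancel₀, one_smul]
  exact Nat.cast_ne_zero.2 hM.ne'

/-- Representatives of the classes of `(1/M) Q^∨` modulo `Q^∨`. -/
noncomputable def gridPoint (M : ℕ) (y : Fin n → ZMod M) : V :=
  (M : ℝ)⁻¹ • ∑ i, (y i).val • S.simpleCoroot i

theorem gridPoint_mem (M : ℕ) (y : Fin n → ZMod M) : S.gridPoint M y ∈ S.refinedLattice M :=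
  ⟨_, sum_mem fun _ _ => nsmul_mem (S.coroot_mem_Qdual _) _, rfl⟩

theorem repr_gridPoint (M : ℕ) (y : Fin n → ZMod M) (i : Fin n) :
    S.corootBasis.repr (S.gridPoint M y) i = (M : ℝ)⁻¹ * (y i).val := by
  rw [gridPoint, map_smul, map_sum]
  simp only [map_nsmul, ← corootBasis_apply, Module.Basis.repr_self, Finsupp.smul_apply,
    Finsupp.coe_finsetSum, Finset.sum_apply, smul_eq_mul, Finsupp.single_apply]
  simp

theorem existsUnique_gridPoint {M : ℕ} (hM : 0 < M) {x : V} (hx : x ∈ S.refinedLattice M) :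
    ∃! y, x - S.gridPoint M y ∈ S.Qdual := by
  have : NeZero M := ⟨hM.ne'⟩
  have hM' : (M : ℝ) ≠ 0 := Nat.cast_ne_zero.2 hM.ne'
  obtain ⟨q, hq, rfl⟩ := hx
  choose k hk using S.mem_Qdual_iff.1 hq
  have key : ∀ y : Fin n → ZMod M,
      (M : ℝ)⁻¹ • q - S.gridPoint M y ∈ S.Qdual ↔ y = fun i => (k i : ZMod M) := by
    intro y
    rw [mem_Qdual_iff, funext_iff]
    refine forall_congr' fun i => ?_
    rw [map_sub, Finsupp.sub_apply, repr_gridPoint, map_smul, Finsupp.smul_apply, hk, smul_eq_mul,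
      ← mul_sub]
    constructor
    · rintro ⟨m, hm⟩
      rw [inv_mul_eq_iff_eq_mul₀ hM'] at hm
      have h2 : k i - ((y i).val : ℤ) = M * m := by exact_mod_cast hm
      have h3 := congrArg (Int.cast (R := ZMod M)) h2
      push_cast at h3
      rw [ZMod.natCast_val, ZMod.cast_id', id, ZMod.natCast_self, zero_mul, sub_eq_zero] at h3
      exact h3.symm
    · intro h
      refine ⟨k i / M, ?_⟩
      rw [inv_mul_eq_iff_eq_mul₀ hM', h]
      have h2 := ZMod.val_intCast (n := M) (k i)
      have h3 := Int.emod_add_mul_ediv (k i) M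
      rw [← h2] at h3
      have h4 : (((k i : ZMod M).val : ℤ) : ℝ) + M * ((k i / M : ℤ) : ℝ) = k i := by
        exact_mod_cast h3
      rw [← h4]
      push_cast
      ring
  exact ⟨_, (key _).2 rfl, fun y hy => (key y).1 hy⟩

open Classical in
/-- Orthogonality of the characters of `(1/M) Q^∨ / Q^∨`. -/
theorem sum_expTurn_gridPoint {M : ℕ} [NeZero M] {μ : V} (hμ : μ ∈ S.weightLattice) :
    ∑ y : Fin n → ZMod M, expTurn ⟪μ, S.gridPoint M y⟫_ℝ =
      if (M : ℝ)⁻¹ • μ ∈ S.weightLattice then (M : ℂ) ^ n else 0 := by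
  have hM' : (M : ℝ) ≠ 0 := Nat.cast_ne_zero.2 (NeZero.ne M)
  choose k hk using hμ
  have h1 : ∀ y : Fin n → ZMod M, expTurn ⟪μ, S.gridPoint M y⟫_ℝ =
      ∏ i, ZMod.stdAddChar (y i * (k i : ZMod M)) := by
    intro y
    rw [gridPoint, real_inner_smul_right, inner_sum, Finset.mul_sum, expTurn_sum]
    refine Finset.prod_congr rfl fun i _ => ?_
    have h2 : y i * (k i : ZMod M) = (((y i).val * k i : ℤ) : ZMod M) := by
      push_cast
      rw [ZMod.natCast_val, ZMod.cast_id', id]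
    rw [h2, ZMod.stdAddChar_coe, expTurn, ← Nat.cast_smul_eq_nsmul ℝ, real_inner_smul_right, hk]
    congr 1
    push_cast
    field_simp
  simp only [h1]
  -- The sum factors over the coordinates, and a factor is a full character sum over `ZMod M`: it is
  -- `M` if `M` divides `k i` and `0` otherwise.
  rw [← Fintype.prod_sum fun i (j : ZMod M) => ZMod.stdAddChar (j * (k i : ZMod M))]
  simp only [AddChar.sum_mulShift _ (ZMod.isPrimitive_stdAddChar M), ZMod.card, Nat.cast_ite,
    Nat.cast_zero]
  rw [Finset.prod_ite_zero, Finset.prod_const, Finset.card_univ, Fintype.card_fin]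
  congr 1
  refine propext ⟨fun h i => ?_, fun h i _ => ?_⟩
  · obtain ⟨m, hm⟩ := (ZMod.intCast_zmod_eq_zero_iff_dvd _ _).1 (h i (Finset.mem_univ i))
    refine ⟨m, ?_⟩
    rw [real_inner_smul_left, hk, hm, inv_mul_eq_iff_eq_mul₀ hM']
    push_cast
    rfl
  · obtain ⟨m, hm⟩ := h i
    rw [real_inner_smul_left, hk, inv_mul_eq_iff_eq_mul₀ hM'] at hm
    exact (ZMod.intCast_zmod_eq_zero_iff_dvd _ _).2 ⟨m, by exact_mod_cast hm⟩

/-! ### Summation over the points of the fundamental domain -/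

/-- Two points of `F` in the same class modulo `Q^∨` are equal, so these points inject into `(ZMod
M)^n`. -/
theorem finite_refinedLattice_inter_F {M : ℕ} (hM : 0 < M) :
    (S.refinedLattice M ∩ S.F).Finite := by
  have : NeZero M := ⟨hM.ne'⟩
  choose! y hy using fun x (hx : x ∈ S.refinedLattice M) => (S.existsUnique_gridPoint hM hx).exists
  refine Set.Finite.of_injOn (f := y) (t := Set.univ) (fun _ _ => Set.mem_univ _) ?_
    Set.finite_univ
  intro s hs t ht hst
  have h := sub_mem (hy s hs.1) (hy t ht.1)
  rw [hst, sub_sub_sub_cancel_right] at h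
  have h2 := map_add_eq_self_of_mem_F (one_mem S.W) h ht.2 (by simpa using hs.2)
  simpa using h2

theorem finite_points (σ : S.W →* ℤˣ) {M : ℕ} (hM : 0 < M) : (S.points σ M).Finite :=
  (S.finite_refinedLattice_inter_F hM).subset fun _ hs => ⟨hs.1, hs.2.1⟩

theorem card_stabilizer_Waff_ne_zero (x : V) :
    Nat.card (MulAction.stabilizer S.Waff x) ≠ 0 := by
  have := S.finite_W
  have : Finite (MulAction.stabilizer S.Waff x) :=
    Finite.of_equiv _ (LatticeSemidirect.stabilizerEquiv x).symm
  exact Nat.card_pos.ne'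

/-- The orbit decomposition of `(1/M) Q^∨ / Q^∨` under the Weyl group. -/
theorem sum_ε_mul_eq_sum_gridPoint {M : ℕ} [NeZero M] (hM : 0 < M) (f : V → ℂ)
    (hf : ∀ w ∈ S.W, ∀ q ∈ S.Qdual, ∀ x, f (w x + q) = f x) :
    ∑ s ∈ (S.finite_refinedLattice_inter_F hM).toFinset, (S.ε s : ℂ) * f s =
      ∑ y, f (S.gridPoint M y) := by
  classical
  have := S.finite_W
  have := Fintype.ofFinite S.W
  set T := (S.finite_refinedLattice_inter_F hM).toFinset with hT
  have hmemT : ∀ s, s ∈ T ↔ s ∈ S.refinedLattice M ∩ S.F := fun s =>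
    (S.finite_refinedLattice_inter_F hM).mem_toFinset
  set c : V → ℂ := fun s => f s / Nat.card (MulAction.stabilizer S.Waff s) with hc
  -- Double counting of pairs `(w, y)` with `w s` in the class of `y`: each `w` has exactly one `y`,
  -- so `|W|` copies of `f s / |Stab s|` make up the term of `s`.
  have h1 : ∀ s ∈ T, (S.ε s : ℂ) * f s = ∑ w : S.W, ∑ y : Fin n → ZMod M,
      if (w : V ≃ₗ[ℝ] V) s - S.gridPoint M y ∈ S.Qdual then c s else 0 := by
    intro s hs
    have h2 : ∀ w : S.W, (∑ y : Fin n → ZMod M,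
        if (w : V ≃ₗ[ℝ] V) s - S.gridPoint M y ∈ S.Qdual then c s else 0) = c s := by
      intro w
      have hws : (w : V ≃ₗ[ℝ] V) s ∈ S.refinedLattice M := by
        simpa using S.map_add_mem_refinedLattice hM ((hmemT s).1 hs).1 w.2 (zero_mem _)
      obtain ⟨y, hy, hy'⟩ := S.existsUnique_gridPoint hM hws
      rw [Finset.sum_eq_single y, if_pos hy]
      · intro z _ hz
        exact if_neg fun h => hz (hy' z h)
      · simp
    rw [Finset.sum_congr rfl fun w _ => h2 w, Finset.sum_const, Finset.card_univ, hc, ε,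
      ← Nat.card_eq_fintype_card, nsmul_eq_mul]
    push_cast
    ring
  rw [Finset.sum_congr rfl h1, Finset.sum_congr rfl fun s _ => Finset.sum_comm, Finset.sum_comm]
  refine Finset.sum_congr rfl fun y _ => ?_
  obtain ⟨v, hv, q, hq, hF⟩ := S.exists_map_add_mem_F (S.gridPoint M y)
  set s := v (S.gridPoint M y) + q with hs
  have hsT : s ∈ T := (hmemT s).2
    ⟨S.map_add_mem_refinedLattice hM (S.gridPoint_mem M y) hv hq, hF⟩
  rw [Finset.sum_eq_single s]
  · rw [← Finset.sum_filter, Finset.sum_const, nsmul_eq_mul]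
    -- If `v` carries `y` to `s` modulo `Q^∨`, then `w s` is in the class of `y` exactly when `v w`
    -- fixes `s` modulo `Q^∨`; so these `w` form a coset of the size of the stabilizer.
    have hcard : (Finset.univ.filter fun w : S.W =>
        (w : V ≃ₗ[ℝ] V) s - S.gridPoint M y ∈ S.Qdual).card =
          Nat.card (MulAction.stabilizer S.Waff s) := by
      rw [Nat.card_congr (LatticeSemidirect.stabilizerEquiv s), ← Fintype.card_subtype,
        ← Nat.card_eq_fintype_card]
      refine Nat.card_congr ((Equiv.mulLeft (⟨v, hv⟩ : S.W)).subtypeEquiv fun w => ?_)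
      have h2 : s - v ((w : V ≃ₗ[ℝ] V) s) =
          q - v ((w : V ≃ₗ[ℝ] V) s - S.gridPoint M y) := by
        rw [map_sub, hs]
        abel
      change _ ↔ s - v ((w : V ≃ₗ[ℝ] V) s) ∈ S.Qdual
      rw [h2]
      refine ⟨fun h => sub_mem hq (S.Qdual_stable v hv _ h), fun h => ?_⟩
      have h3 := S.Qdual_stable _ (inv_mem hv) _ (sub_mem hq h)
      rw [sub_sub_cancel] at h3
      rwa [show v⁻¹ (v ((w : V ≃ₗ[ℝ] V) s - S.gridPoint M y)) = _ from
        v.symm_apply_apply _] at h3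
    rw [hcard, hc, mul_div_cancel₀ _ (Nat.cast_ne_zero.2 (S.card_stabilizer_Waff_ne_zero s)), hs,
      hf v hv q hq]
  · intro t ht hts
    refine Finset.sum_eq_zero fun w _ => if_neg fun h => hts ?_
    have h2 : s = (v * w) t + (q - v ((w : V ≃ₗ[ℝ] V) t - S.gridPoint M y)) := by
      rw [map_sub, hs]
      change _ = v ((w : V ≃ₗ[ℝ] V) t) + _
      abel
    have h3 := map_add_eq_self_of_mem_F (mul_mem hv w.2)
      (sub_mem hq (S.Qdual_stable v hv _ h)) ((hmemT t).1 ht).2 (h2 ▸ hF)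
    rw [← h2] at h3
    exact h3.symm
  · exact fun h => absurd hsT h

/-! ### Weyl orbit functions -/

theorem orbitFunction_eq [Fintype S.W] (σ : S.W →* ℤˣ) (b a : V) : S.orbitFunction σ b a =
    ∑ w : S.W, ((σ w : ℤ) : ℂ) * expTurn ⟪(w : V ≃ₗ[ℝ] V) b, a⟫_ℝ :=
  finsum_eq_sum_of_fintype _

/-- Reindex by `w ↦ v w`; the shift by `q` only adds integers to the exponents because `P` pairs
integrally with `Q^∨`. -/
theorem orbitFunction_map_add (σ : S.W →* ℤˣ) {b : V} (hb : b ∈ S.weightLattice) (v : S.W) {q : V}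
    (hq : q ∈ S.Qdual) (a : V) :
    S.orbitFunction σ b ((v : V ≃ₗ[ℝ] V) a + q) = ((σ v : ℤ) : ℂ) * S.orbitFunction σ b a := by
  have := S.finite_W
  have := Fintype.ofFinite S.W
  rw [orbitFunction_eq, orbitFunction_eq, Finset.mul_sum, ← Equiv.sum_comp (Equiv.mulLeft v)]
  refine Finset.sum_congr rfl fun w _ => ?_
  obtain ⟨k, hk⟩ := S.inner_mem_int (S.weightLattice_stable _ (v * w).2 b hb) hq
  rw [Equiv.coe_mulLeft, inner_add_right, hk, expTurn_add, expTurn_intCast, map_mul, mul_one]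
  have : ⟪((v * w : S.W) : V ≃ₗ[ℝ] V) b, (v : V ≃ₗ[ℝ] V) a⟫_ℝ = ⟪(w : V ≃ₗ[ℝ] V) b, a⟫_ℝ :=
    inner_map_map v.2 _ _
  rw [this]
  push_cast
  ring

theorem units_int_cast_mul_self (u : ℤˣ) : ((u : ℤ) : ℂ) * ((u : ℤ) : ℂ) = 1 := by
  rw [← Int.cast_mul, ← Units.val_mul, Int.units_mul_self]
  simp

/-- A stabilizer element of sign `-1` forces the value to equal its own negative. -/
theorem orbitFunction_eq_zero (σ : S.W →* ℤˣ) {b : V} (hb : b ∈ S.weightLattice) {a : V}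
    (ha : a ∈ S.F) (ha' : a ∉ S.Fsign σ) : S.orbitFunction σ b a = 0 := by
  have : ∃ g ∈ MulAction.stabilizer S.Waff a, σ (LatticeSemidirect.retraction g) ≠ 1 := by
    by_contra! h
    exact ha' ⟨ha, h⟩
  obtain ⟨g, hg, hσ⟩ := this
  have h1 := S.orbitFunction_map_add σ hb (LatticeSemidirect.retraction g)
    (LatticeSemidirect.trans g).2 a
  rw [← LatticeSemidirect.smul_def, MulAction.mem_stabilizer_iff.1 hg,
    (Int.units_eq_one_or _).resolve_left hσ] at h1
  push_cast at h1
  rw [neg_one_mul] at h1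
  exact self_eq_neg.1 h1

/-- The sum may be extended from `F^σ` to `F`, where the added terms vanish; the summand is then
invariant because the sign occurs squared. -/
theorem scalarProduct_orbitFunction_eq (σ : S.W →* ℤˣ) {M : ℕ} [NeZero M] {b b' : V}
    (hb : b ∈ S.weightLattice) (hb' : b' ∈ S.weightLattice) :
    S.scalarProduct σ M (fun s => S.orbitFunction σ b s) (fun s => S.orbitFunction σ b' s) =
      ∑ y, S.orbitFunction σ b (S.gridPoint M y) *
        starRingEnd ℂ (S.orbitFunction σ b' (S.gridPoint M y)) := by
  have hM : 0 < M := Nat.pos_of_neZero M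
  rw [← S.sum_ε_mul_eq_sum_gridPoint hM
    (fun x => S.orbitFunction σ b x * starRingEnd ℂ (S.orbitFunction σ b' x)), scalarProduct,
    finsum_set_coe_eq_finsum_mem (f := fun s => (S.ε s : ℂ) * S.orbitFunction σ b s *
      starRingEnd ℂ (S.orbitFunction σ b' s)),
    finsum_mem_eq_finite_toFinset_sum _ (S.finite_points σ hM)]
  · simp only [mul_assoc]
    refine Finset.sum_subset (fun s hs => ?_) fun s hs hs' => ?_
    · rw [Set.Finite.mem_toFinset] at hs ⊢
      exact ⟨hs.1, hs.2.1⟩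
    · rw [Set.Finite.mem_toFinset] at hs hs'
      rw [S.orbitFunction_eq_zero σ hb hs.2 fun h => hs' ⟨hs.1, h⟩, zero_mul, mul_zero]
  · intro w hw q hq x
    rw [S.orbitFunction_map_add σ hb ⟨w, hw⟩ hq x, S.orbitFunction_map_add σ hb' ⟨w, hw⟩ hq x,
      map_mul, map_intCast, mul_mul_mul_comm, units_int_cast_mul_self, one_mul]

open Classical in
theorem sum_gridPoint_orbitFunction [Fintype S.W] (σ : S.W →* ℤˣ) {M : ℕ} [NeZero M] {b b' : V}
    (hb : b ∈ S.weightLattice) (hb' : b' ∈ S.weightLattice) :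
    ∑ y, S.orbitFunction σ b (S.gridPoint M y) *
        starRingEnd ℂ (S.orbitFunction σ b' (S.gridPoint M y)) =
      ∑ v : S.W, ∑ w : S.W, ((σ v : ℤ) : ℂ) * ((σ w : ℤ) : ℂ) *
        if (M : ℝ)⁻¹ • ((v : V ≃ₗ[ℝ] V) b - (w : V ≃ₗ[ℝ] V) b') ∈ S.weightLattice
        then (M : ℂ) ^ n else 0 := by
  simp only [orbitFunction_eq, map_sum, Finset.sum_mul_sum]
  rw [Finset.sum_comm]
  refine Finset.sum_congr rfl fun v _ => ?_
  rw [Finset.sum_comm]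
  refine Finset.sum_congr rfl fun w _ => ?_
  rw [← S.sum_expTurn_gridPoint (sub_mem (S.weightLattice_stable _ v.2 b hb)
    (S.weightLattice_stable _ w.2 b' hb')), Finset.mul_sum]
  refine Finset.sum_congr rfl fun y _ => ?_
  rw [map_mul, map_intCast, star_expTurn, mul_mul_mul_comm, ← expTurn_add, inner_sub_left,
    sub_eq_add_neg]

theorem scalarProduct_of_ne (σ : S.W →* ℤˣ) {M : ℕ} [NeZero M] {l l' : V}
    (hl : l ∈ S.weights σ M) (hl' : l' ∈ S.weights σ M) (hne : l ≠ l') :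
    S.scalarProduct σ M (fun s => S.orbitFunction σ l s) (fun s => S.orbitFunction σ l' s) = 0 := by
  have := S.finite_W
  have := Fintype.ofFinite S.W
  have hM' : (M : ℝ) ≠ 0 := Nat.cast_ne_zero.2 (NeZero.ne M)
  rw [S.scalarProduct_orbitFunction_eq σ hl.1 hl'.1, S.sum_gridPoint_orbitFunction σ hl.1 hl'.1]
  refine Finset.sum_eq_zero fun v _ => Finset.sum_eq_zero fun w _ => ?_
  rw [if_neg, mul_zero]
  intro h
  obtain ⟨-, b, hb, rfl⟩ := hl
  obtain ⟨-, b', hb', rfl⟩ := hl'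
  rw [map_smul, map_smul, ← smul_sub, inv_smul_smul₀ hM'] at h
  refine hne (congrArg _ (S.eq_of_mem_FP hb'.1 hb.1 (mul_mem (inv_mem v.2) w.2)
    (S.weightLattice_stable _ (inv_mem v.2) _ h) ?_).symm)
  rw [map_sub]
  change b = (v : V ≃ₗ[ℝ] V).symm _ + ((v : V ≃ₗ[ℝ] V).symm _ - (v : V ≃ₗ[ℝ] V).symm _)
  simp

theorem scalarProduct_self (σ : S.W →* ℤˣ) {M : ℕ} [NeZero M] {l : V} (hl : l ∈ S.weights σ M) :
    S.scalarProduct σ M (fun s => S.orbitFunction σ l s) (fun s => S.orbitFunction σ l s) =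
      (Nat.card S.W : ℂ) * (M : ℂ) ^ n * (S.hP M l : ℂ) := by
  classical
  have := S.finite_W
  have := Fintype.ofFinite S.W
  have hM' : (M : ℝ) ≠ 0 := Nat.cast_ne_zero.2 (NeZero.ne M)
  rw [S.scalarProduct_orbitFunction_eq σ hl.1 hl.1, S.sum_gridPoint_orbitFunction σ hl.1 hl.1]
  obtain ⟨-, b, hb, rfl⟩ := hl
  have hb2 : ∀ u : S.W, b - (u : V ≃ₗ[ℝ] V) b ∈ S.weightLattice → σ u = 1 := fun u hu =>
    hb.2 ((LatticeSemidirect.stabilizerEquiv b).symm ⟨u, hu⟩).1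
      ((LatticeSemidirect.stabilizerEquiv b).symm ⟨u, hu⟩).2
  have hcard : S.hP M ((M : ℝ) • b) =
      (Finset.univ.filter fun u : S.W => b - (u : V ≃ₗ[ℝ] V) b ∈ S.weightLattice).card := by
    rw [hP, inv_smul_smul₀ hM', Nat.card_congr (LatticeSemidirect.stabilizerEquiv b),
      ← Fintype.card_subtype, ← Nat.card_eq_fintype_card]
  have hinner : ∀ v : S.W, (∑ w : S.W, ((σ v : ℤ) : ℂ) * ((σ w : ℤ) : ℂ) *
      if (M : ℝ)⁻¹ • ((v : V ≃ₗ[ℝ] V) ((M : ℝ) • b) - (w : V ≃ₗ[ℝ] V) ((M : ℝ) • b)) ∈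
        S.weightLattice then (M : ℂ) ^ n else 0) = (M : ℂ) ^ n * S.hP M ((M : ℝ) • b) := by
    intro v
    -- Substituting `w = v u` reduces the condition to `b - u b ∈ P`, that is, to `u` being the
    -- linear part of a stabilizer element, where `σ u = 1`.
    rw [← Equiv.sum_comp (Equiv.mulLeft v), hcard, Finset.card_filter, Nat.cast_sum,
      Finset.mul_sum]
    refine Finset.sum_congr rfl fun u _ => ?_
    rw [map_smul, map_smul, ← smul_sub, inv_smul_smul₀ hM']
    have h1 : (v : V ≃ₗ[ℝ] V) b - ((Equiv.mulLeft v u : S.W) : V ≃ₗ[ℝ] V) b =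
        (v : V ≃ₗ[ℝ] V) (b - (u : V ≃ₗ[ℝ] V) b) := by
      rw [map_sub]
      rfl
    have h2 : (v : V ≃ₗ[ℝ] V) (b - (u : V ≃ₗ[ℝ] V) b) ∈ S.weightLattice ↔
        b - (u : V ≃ₗ[ℝ] V) b ∈ S.weightLattice := by
      refine ⟨fun h => ?_, S.weightLattice_stable _ v.2 _⟩
      have := S.weightLattice_stable _ (inv_mem v.2) _ h
      rwa [show (v : V ≃ₗ[ℝ] V)⁻¹ ((v : V ≃ₗ[ℝ] V) (b - (u : V ≃ₗ[ℝ] V) b)) = _ from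
        (v : V ≃ₗ[ℝ] V).symm_apply_apply _] at this
    rw [h1]
    by_cases h : b - (u : V ≃ₗ[ℝ] V) b ∈ S.weightLattice
    · rw [if_pos (h2.2 h), if_pos h, Equiv.coe_mulLeft, map_mul, hb2 u h, mul_one,
        units_int_cast_mul_self, one_mul, Nat.cast_one, mul_one]
    · rw [if_neg (h2.not.2 h), if_neg h, mul_zero, Nat.cast_zero, mul_zero]
  rw [Finset.sum_congr rfl fun v _ => hinner v, Finset.sum_const, Finset.card_univ,
    ← Nat.card_eq_fintype_card, nsmul_eq_mul, mul_assoc]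

end SimpleRoots

/-! ### Discrete orthogonality of the orbit functions -/

theorem mainTheorem2 {ι V : Type*} [NormedAddCommGroup V] [InnerProductSpace ℝ V] {n : ℕ}
    (S : SimpleRoots ι V n) (σ : S.W →* ℤˣ) (M : ℕ) (hM : 0 < M) :
    Finite S.W ∧ (S.points σ M).Finite ∧
    ∀ l ∈ S.weights σ M, ∀ l' ∈ S.weights σ M,
      S.scalarProduct σ M (fun s => S.orbitFunction σ l s) (fun s => S.orbitFunction σ l' s) =
        (Nat.card S.W : ℂ) * (M : ℂ) ^ n * (S.hP M l : ℂ) *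
          (open Classical in if l = l' then 1 else 0) := by
  have : NeZero M := ⟨hM.ne'⟩
  refine ⟨S.finite_W, S.finite_points σ hM, fun l hl l' hl' => ?_⟩
  split_ifs with h
  · subst h
    rw [mul_one]
    exact S.scalarProduct_self σ hl
  · rw [mul_zero]
    exact S.scalarProduct_of_ne σ hl hl' h
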